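/- Let $d\in\mathbb{N}$, $d\ge 1$, and let $\Omega\subseteq\mathbb{R}^d$ be a bounded open set with $\Omega=\operatorname{int}(\overline{\Omega})$ (for instance, a bounded simplicial Lipschitz domain), whose boundary is decomposed into pairwise disjoint relatively open parts $\Gamma_D,\Gamma_N,\Gamma_C$ with $\partial\Omega=\overline{\Gamma}_D\cup\overline{\Gamma}_N\cup\overline{\Gamma}_C$. Let $\mathcal{T}_h$ be a finite conforming simplicial triangulation of $\overline\Omega$, let $\mathcal{S}_h$ be the set of its sides ($(d-1)$-dimensional faces of elements), $\mathcal{S}_h^i$ the set of interior sides (sides shared by two elements), $\mathcal{S}_h^{\partial\Omega}$ the set of sides contained in $\partial\Omega$ and, for $\gamma\in\{\Gamma_D,\Gamma_N,\Gamma_C\}$, $\mathcal{S}_h^\gamma$ the set of those boundary sides whose relative interior lies in $\gamma$; assume $\mathcal{S}_h^{\partial\Omega}=\mathcal{S}_h^{\Gamma_D}\cup\mathcal{S}_h^{\Gamma_N}\cup\mathcal{S}_h^{\Gamma_C}$. Below, statements and inner products on $\Gamma_D,\Gamma_N,\Gamma_C$ are understood on the union of the sides in the corresponding set $\mathcal{S}_h^\gamma$.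 Let $\mathcal{L}^k(\mathcal{T}_h)$ be the element-wise polynomials of degree at most $k$ and $\mathcal{L}^0(\mathcal{M})$ the functions that are constant on each side in $\mathcal{M}\subseteq\mathcal{S}_h$; let $\Pi_h$ and $\pi_h$ denote taking mean values on elements and on sides, respectively, and let $\nabla_h$ be the element-wise gradient. The outward unit normals of $\Omega$ and of an element $T$ are $n$ and $n_T$; $[\![\cdot]\!]_S$ is the jump across an interior side $S$, and $[\![y_h\cdot n]\!]_S=y_h|_{T_+}\cdot n_{T_+}+y_h|_{T_-}\cdot n_{T_-}$ if $S=T_+\cap T_-$. Put $$\mathcal{S}^{1,cr}(\mathcal{T}_h)=\{v_h\in\mathcal{L}^1(\mathcal{T}_h)\mid \pi_h[\![v_h]\!]_S=0\text{ for all }S\in\mathcal{S}_h^i\},$$ $$\mathcal{R}T^0(\mathcal{T}_h)=\{y_h\in(\mathcal{L}^1(\mathcal{T}_h))^d\mid y_h|_T\cdot n_T\text{ is constant on each side of }T\text{ for all }T\in\mathcal{T}_h,\ [\![y_h\cdot n]\!]_S=0\text{ on each }S\in\mathcal{S}_h^i\}.$$ Let $f_h\in\mathcal{L}^0(\mathcal{T}_h)$,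 $g_h\in\mathcal{L}^0(\mathcal{S}_h^{\Gamma_N})$, $u_D^h\in\mathcal{L}^0(\mathcal{S}_h^{\Gamma_D})$ and $\chi_h\in\mathcal{L}^0(\mathcal{S}_h^{\Gamma_D}\cup\mathcal{S}_h^{\Gamma_C})$ with $\chi_h=u_D^h$ on $\Gamma_D$. Let $u_h^{cr}$ be a discrete primal solution, i.e. an element of $$K_h^{cr}=\{v_h\in\mathcal{S}^{1,cr}(\mathcal{T}_h)\mid \pi_hv_h=u_D^h\text{ on }\Gamma_D,\ \pi_hv_h\ge\chi_h\text{ on }\Gamma_C\}$$ that minimizes over $\mathcal{S}^{1,cr}(\mathcal{T}_h)$ the functional $$I_h^{cr}(v_h)=\tfrac12\|\nabla_hv_h\|_\Omega^2-(f_h,\Pi_hv_h)_\Omega-(g_h,\pi_hv_h)_{\Gamma_N}\ \text{ if }v_h\in K_h^{cr},\qquad I_h^{cr}(v_h)=+\infty\ \text{ otherwise}.$$ Define the discrete flux $$z_h^{rt}=\nabla_hu_h^{cr}-\frac{f_h}{d}\,(\mathrm{id}_{\mathbb{R}^d}-\Pi_h\mathrm{id}_{\mathbb{R}^d})\in(\mathcal{L}^1(\mathcal{T}_h))^d.$$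 Then $z_h^{rt}\in\mathcal{R}T^0(\mathcal{T}_h)$; it satisfies the discrete admissibility conditions $$\operatorname{div}z_h^{rt}=-f_h\text{ in }\Omega,\qquad z_h^{rt}\cdot n=g_h\text{ on }\Gamma_N,\qquad z_h^{rt}\cdot n\ge0\text{ on }\Gamma_C,$$ and the discrete convex optimality relations $$\Pi_hz_h^{rt}=\nabla_hu_h^{cr}\text{ in }\Omega,\qquad z_h^{rt}\cdot n\,(\pi_hu_h^{cr}-\chi_h)=0\text{ on }\Gamma_C;$$ and it is a discrete dual solution, i.e. it maximizes over $\mathcal{R}T^0(\mathcal{T}_h)$ the functional $$D_h^{rt}(y_h)=-\tfrac12\|\Pi_hy_h\|_\Omega^2+(y_h\cdot n,\chi_h)_{\Gamma_D\cup\Gamma_C}\ \text{ if }y_h\in K_h^{rt,*},\qquad D_h^{rt}(y_h)=-\infty\ \text{ otherwise},$$ where $K_h^{rt,*}=\{y_h\in\mathcal{R}T^0(\mathcal{T}_h)\mid\operatorname{div}y_h=-f_h\text{ in }\Omega,\ y_h\cdot n=g_h\text{ on }\Gamma_N,\ y_h\cdot n\ge0\text{ on }\Gamma_C\}$. -/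

import Mathlib

open scoped MeasureTheory

/-- The Euclidean space `ℝᵈ`. -/
abbrev Eucl (d : ℕ) : Type := EuclideanSpace ℝ (Fin d)

/-- A (conforming, simplicial) triangulation of the set `Ω ⊆ ℝᵈ`: a finite geometric simplicial
complex, all of whose faces are faces of `d`-dimensional simplices, and whose simplices cover
exactly the closure of `Ω`. Simplices are given by their finite sets of vertices. -/
structure Mesh (d : ℕ) (Ω : Set (Eucl d)) extends Geometry.SimplicialComplex ℝ (Eucl d) where
  finite_faces : faces.Finite
  exists_elem : ∀ s ∈ faces, ∃ t ∈ faces, s ⊆ t ∧ t.card = d + 1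
  space_eq : toSimplicialComplex.space = closure Ω

/-- The decomposition of `∂Ω` into pairwise disjoint relatively open parts `Γ_D`, `Γ_N`, `Γ_C`
whose closures cover `∂Ω`. -/
structure IsBoundaryDecomposition {d : ℕ} (Ω ΓD ΓN ΓC : Set (Eucl d)) : Prop where
  openD : ∃ U, IsOpen U ∧ ΓD = U ∩ frontier Ω
  openN : ∃ U, IsOpen U ∧ ΓN = U ∩ frontier Ω
  openC : ∃ U, IsOpen U ∧ ΓC = U ∩ frontier Ω
  disjointDN : Disjoint ΓD ΓN
  disjointDC : Disjoint ΓD ΓC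
  disjointNC : Disjoint ΓN ΓC
  cover : frontier Ω = closure ΓD ∪ closure ΓN ∪ closure ΓC

namespace Mesh

noncomputable section

variable {d : ℕ} {Ω : Set (Eucl d)} (𝒯 : Mesh d Ω)

/-! ### Elements and sides -/

/-- The elements `T ∈ 𝒯_h`, i.e. the `d`-simplices of the triangulation. -/
def Elem : Type := {T : Finset (Eucl d) // T ∈ 𝒯.faces ∧ T.card = d + 1}

/-- The sides `S ∈ 𝒮_h`, i.e. the `(d-1)`-simplices of the triangulation. -/
def Side : Type := {S : Finset (Eucl d) // S ∈ 𝒯.faces ∧ S.card = d}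

instance : Finite 𝒯.Elem := (𝒯.finite_faces.subset fun _ h => h.1).to_subtype

instance : Finite 𝒯.Side := (𝒯.finite_faces.subset fun _ h => h.1).to_subtype

instance : Fintype 𝒯.Elem := Fintype.ofFinite _

instance : Fintype 𝒯.Side := Fintype.ofFinite _

variable {𝒯}

/-- The closed simplex `T ⊆ ℝᵈ`. -/
def Elem.carrier (T : 𝒯.Elem) : Set (Eucl d) := convexHull ℝ (T.1 : Set (Eucl d))

/-- The closed simplex `S ⊆ ℝᵈ`. -/
def Side.carrier (S : 𝒯.Side) : Set (Eucl d) := convexHull ℝ (S.1 : Set (Eucl d))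

/-- The volume `|T|`. -/
def Elem.vol (T : 𝒯.Elem) : ℝ := MeasureTheory.volume.real T.carrier

/-- `S` is a side of the element `T`. -/
def Side.IsSideOf (S : 𝒯.Side) (T : 𝒯.Elem) : Prop := S.1 ⊆ T.1

/-- The surface measure on sides: the `(d-1)`-dimensional Hausdorff measure, normalised so that it
is the Lebesgue measure on `(d-1)`-dimensional affine subspaces. -/
def surf (d : ℕ) : MeasureTheory.Measure (Eucl d) := μHE[d - 1]

/-- The area `|S|`. -/
def Side.area (S : 𝒯.Side) : ℝ := (surf d).real S.carrier

/-- `S ∈ 𝒮_h^{∂Ω}`: the side lies on the boundary of `Ω`. -/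
def Side.IsBoundary (S : 𝒯.Side) : Prop := S.carrier ⊆ frontier Ω

theorem Side.exists_isSideOf (S : 𝒯.Side) : ∃ T : 𝒯.Elem, S.IsSideOf T := by
  obtain ⟨t, ht, hst, hc⟩ := 𝒯.exists_elem S.1 S.2.1
  exact ⟨⟨t, ht, hc⟩, hst⟩

/-- An element having `S` as a side (the only one if `S` is a boundary side). -/
def Side.elem (S : 𝒯.Side) : 𝒯.Elem := S.exists_isSideOf.choose

/-- The outward unit normal `n_T` of the element `T` on its side `S`: the vector from the
barycentre of `T` to the barycentre of `S` points outward, and its component orthogonal to `S`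
is normalised. -/
def normal (T : 𝒯.Elem) (S : 𝒯.Side) : Eucl d :=
  NormedSpace.normalize
    ((vectorSpan ℝ (S.1 : Set (Eucl d)))ᗮ.starProjection
      (S.1.centroid ℝ id - T.1.centroid ℝ id))

variable (𝒯)

open Classical in
/-- `𝒮_h^γ`: the boundary sides whose relative interior is contained in `γ ⊆ ∂Ω`. -/
def sidesOn (γ : Set (Eucl d)) : Finset 𝒯.Side :=
  {S : 𝒯.Side | S.IsBoundary ∧ intrinsicInterior ℝ S.carrier ⊆ γ}

/-- The triangulation resolves the boundary parts: each boundary side belongs to one of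
`𝒮_h^{Γ_D}`, `𝒮_h^{Γ_N}`, `𝒮_h^{Γ_C}`. -/
def Resolves (ΓD ΓN ΓC : Set (Eucl d)) : Prop :=
  ∀ S : 𝒯.Side, S.IsBoundary →
    S ∈ 𝒯.sidesOn ΓD ∨ S ∈ 𝒯.sidesOn ΓN ∨ S ∈ 𝒯.sidesOn ΓC

/-! ### Element-wise polynomial functions

An element-wise polynomial function is identified with the family of its polynomial pieces
(its restrictions `v_h|_T` to the elements), so that equality almost everywhere is equality of
families, and the trace of `v_h|_T` on a side of `T` is the evaluation of the piece. -/

/-- `ℒ⁰(𝒯_h)`: element-wise constant functions. -/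
abbrev L0 : Type := 𝒯.Elem → ℝ

/-- `(ℒ⁰(𝒯_h))ᵈ`: element-wise constant vector fields. -/
abbrev L0Vec : Type := 𝒯.Elem → Eucl d

/-- `ℒ¹(𝒯_h)`: element-wise affine functions. -/
abbrev L1 : Type := 𝒯.Elem → (Eucl d →ᵃ[ℝ] ℝ)

/-- `(ℒ¹(𝒯_h))ᵈ`: element-wise affine vector fields. -/
abbrev L1Vec : Type := 𝒯.Elem → (Eucl d →ᵃ[ℝ] Eucl d)

/-- Side-wise constant functions on all sides. A side-wise constant function that is only given on
some of the sides is represented by any extension of it; the values on the other sides are never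
used. -/
abbrev SideL0 : Type := 𝒯.Side → ℝ

variable {𝒯}

/-- The element-wise gradient `∇_h v_h`: on `T` it is the (constant) gradient of the affine function
`v_h|_T`, here evaluated at the barycentre of `T`. -/
def grad (v : 𝒯.L1) : 𝒯.L0Vec := fun T => gradient (fun x => v T x) (T.1.centroid ℝ id)

/-- The element-wise divergence `div y_h`; on `T` it is the trace of the linear part (the Jacobian
matrix) of `y_h|_T`. -/
def div (y : 𝒯.L1Vec) : 𝒯.L0 := fun T => LinearMap.trace ℝ (Eucl d) (y T).linear

/-- `Π_h v_h` for functions: the mean value on each element. -/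
def proj (v : 𝒯.L1) : 𝒯.L0 := fun T => ⨍ x in T.carrier, v T x

/-- `Π_h y_h` for vector fields: the mean value on each element. -/
def projVec (y : 𝒯.L1Vec) : 𝒯.L0Vec := fun T => ⨍ x in T.carrier, y T x

/-- The identity of `ℝᵈ` as an element-wise affine vector field. -/
def idField : 𝒯.L1Vec := fun _ => AffineMap.id ℝ (Eucl d)

/-- `(p, q)_Ω` for element-wise constant functions. -/
def innerL0 (p q : 𝒯.L0) : ℝ := ∑ T : 𝒯.Elem, T.vol * (p T * q T)

/-- `‖p‖_Ω²` for element-wise constant vector fields. -/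
def normSq (p : 𝒯.L0Vec) : ℝ := ∑ T : 𝒯.Elem, T.vol * ‖p T‖ ^ 2

/-- `π_h v_h`: the mean value on each side. On an interior side this is only used for functions
whose jump has vanishing mean, so that the choice of the adjacent element is irrelevant. -/
def sideProj (v : 𝒯.L1) : 𝒯.SideL0 := fun S => ⨍ x in S.carrier, v S.elem x ∂(surf d)

/-- The normal trace `y_h · n` on a boundary side `S`, at the point `x ∈ S`; there the outward unit
normal `n` to `Ω` is the outward unit normal of the adjacent element. -/
def normalTrace (y : 𝒯.L1Vec) (S : 𝒯.Side) (x : Eucl d) : ℝ :=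
  inner ℝ (y S.elem x) (normal S.elem S)

/-! ### Finite element spaces -/

/-- `v_h ∈ 𝒮^{1,cr}(𝒯_h)`: on each interior side, the jump of `v_h` has mean value zero. -/
def IsCR (v : 𝒯.L1) : Prop :=
  ∀ (S : 𝒯.Side) (T T' : 𝒯.Elem), T ≠ T' → S.IsSideOf T → S.IsSideOf T' →
    ⨍ x in S.carrier, (v T x - v T' x) ∂(surf d) = 0

/-- `y_h ∈ ℛT⁰(𝒯_h)`: for each element, the normal component is constant on each of its sides, and
the normal jump across each interior side vanishes. -/
def IsRT (y : 𝒯.L1Vec) : Prop :=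
  (∀ (T : 𝒯.Elem) (S : 𝒯.Side), S.IsSideOf T →
    ∃ c : ℝ, ∀ x ∈ S.carrier, inner ℝ (y T x) (normal T S) = c) ∧
  (∀ (S : 𝒯.Side) (T T' : 𝒯.Elem), T ≠ T' → S.IsSideOf T → S.IsSideOf T' →
    ∀ x ∈ S.carrier, inner ℝ (y T x) (normal T S) + inner ℝ (y T' x) (normal T' S) = 0)

/-! ### The discrete primal and dual problems -/

/-- The admissible set `K_h^{cr}`. -/
def primalSet (ΓD ΓC : Set (Eucl d)) (uD χ : 𝒯.SideL0) : Set 𝒯.L1 :=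
  {v | IsCR v ∧ (∀ S ∈ 𝒯.sidesOn ΓD, sideProj v S = uD S) ∧
    (∀ S ∈ 𝒯.sidesOn ΓC, χ S ≤ sideProj v S)}

open Classical in
/-- The discrete primal energy `I_h^{cr}`, with values in `ℝ ∪ {+∞}`. -/
def primalEnergy (ΓD ΓN ΓC : Set (Eucl d)) (f : 𝒯.L0) (g uD χ : 𝒯.SideL0) (v : 𝒯.L1) : EReal :=
  ((1 / 2 * normSq (grad v) - innerL0 f (proj v)
      - ∑ S ∈ 𝒯.sidesOn ΓN, S.area * (g S * sideProj v S) : ℝ) : EReal)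
    + (if v ∈ primalSet ΓD ΓC uD χ then 0 else ⊤)

/-- `u` is a discrete primal solution: it is admissible and minimises the discrete primal energy
over `𝒮^{1,cr}(𝒯_h)`. -/
def IsPrimalSolution (ΓD ΓN ΓC : Set (Eucl d)) (f : 𝒯.L0) (g uD χ : 𝒯.SideL0) (u : 𝒯.L1) : Prop :=
  u ∈ primalSet ΓD ΓC uD χ ∧ IsMinOn (primalEnergy ΓD ΓN ΓC f g uD χ) {v | IsCR v} u

/-- The admissible set `K_h^{rt,*}`. -/
def dualSet (ΓN ΓC : Set (Eucl d)) (f : 𝒯.L0) (g : 𝒯.SideL0) : Set 𝒯.L1Vec :=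
  {y | IsRT y ∧ (∀ T, div y T = -f T) ∧
    (∀ S ∈ 𝒯.sidesOn ΓN, ∀ x ∈ S.carrier, normalTrace y S x = g S) ∧
    (∀ S ∈ 𝒯.sidesOn ΓC, ∀ x ∈ S.carrier, 0 ≤ normalTrace y S x)}

open Classical in
/-- The discrete dual energy `D_h^{rt}`, with values in `ℝ ∪ {-∞}`. -/
def dualEnergy (ΓD ΓN ΓC : Set (Eucl d)) (f : 𝒯.L0) (g χ : 𝒯.SideL0) (y : 𝒯.L1Vec) : EReal :=
  ((-(1 / 2) * normSq (projVec y)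
      + ((∑ S ∈ 𝒯.sidesOn ΓD, ∫ x in S.carrier, normalTrace y S x * χ S ∂(surf d))
        + ∑ S ∈ 𝒯.sidesOn ΓC, ∫ x in S.carrier, normalTrace y S x * χ S ∂(surf d)) : ℝ) : EReal)
    - (if y ∈ dualSet ΓN ΓC f g then 0 else ⊤)

/-- `z` is a discrete dual solution: it maximises the discrete dual energy over `ℛT⁰(𝒯_h)`. -/
def IsDualSolution (ΓD ΓN ΓC : Set (Eucl d)) (f : 𝒯.L0) (g χ : 𝒯.SideL0) (z : 𝒯.L1Vec) : Prop :=
  IsRT z ∧ IsMaxOn (dualEnergy ΓD ΓN ΓC f g χ) {y | IsRT y} z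

/-- The discrete flux `∇_h u_h - (f_h / d) (id - Π_h id)`. -/
def flux (f : 𝒯.L0) (u : 𝒯.L1) : 𝒯.L1Vec := fun T =>
  AffineMap.const ℝ (Eucl d) (grad u T)
    - (f T / d) • (idField T - AffineMap.const ℝ (Eucl d) (projVec (idField (𝒯 := 𝒯)) T))

end

end Mesh

/-! ### Mean values of affine functions over simplices. -/

section SimplexAverage

open MeasureTheory

/-! Write z for the flux. Its correction term vanishes at barycentres, has divergence -f and is
tangent-invariant on each side, so Π z = ∇u, div z = -f and the constancy of the normal components
hold for every u (`projVec_flux`, `div_flux`, `hasConstNormal_flux`). Hence element-wise integration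
by parts turns the first variation of the energy along a Crouzeix–Raviart function φ into a sum over
sides of area times (flow of z minus Neumann datum) times the mean of φ (`primalReal_add_smul`),
where the flow is the sum of the outward normal components from the adjacent elements. The
Crouzeix–Raviart basis function of one side changes the mean on that side only. Testing minimality
with it decouples the sides: flow zero on interior sides, which is the Raviart–Thomas condition;
flow g on Neumann sides; on contact sides a nonnegative flow that vanishes where the constraint is
inactive. Maximality follows by testing the integration-by-parts formula with u, once for z and once
for a competitor y, and using convexity of the square; complementarity gives equality for z where y
has only an inequality (`dualReal_le`). The formula itself is linear algebra in barycentric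
coordinates, once means are vertex averages and area and normal of a side are expressed through the
gradient of the opposite coordinate. That interior sides have two elements and boundary sides one is
deduced from the simplicial complex and Ω = int(closure Ω). -/

theorem AffineBasis.apply_eq_sum_coord_smul {ι V F : Type*} [Fintype ι] [AddCommGroup V]
    [Module ℝ V] [AddCommGroup F] [Module ℝ F] (b : AffineBasis ι ℝ V) (f : V →ᵃ[ℝ] F) (x : V) :
    f x = ∑ i, b.coord i x • f (b i) := by
  conv_lhs => rw [← b.affineCombination_coord_eq_self x]
  rw [Finset.map_affineCombination _ _ _ (b.sum_coord_apply_eq_one x),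
    Finset.affineCombination_eq_linear_combination _ _ _ (b.sum_coord_apply_eq_one x)]
  rfl

/-- The affine map that permutes the points of an affine basis. -/
noncomputable def AffineBasis.permMap {ι V : Type*} [Fintype ι] [AddCommGroup V]
    [Module ℝ V] (b : AffineBasis ι ℝ V) (σ : Equiv.Perm ι) : V →ᵃ[ℝ] V where
  toFun x := ∑ i, b.coord i x • b (σ i)
  linear := ∑ i, (b.coord i).linear.smulRight (b (σ i))
  map_vadd' p v := by
    simp only [LinearMap.sum_apply, LinearMap.smulRight_apply]
    rw [vadd_eq_add (a := ∑ d, _), ← Finset.sum_add_distrib]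
    refine Finset.sum_congr rfl fun i _ => ?_
    rw [← add_smul, AffineMap.map_vadd, vadd_eq_add]

theorem AffineBasis.coord_permMap {ι V : Type*} [Fintype ι] [AddCommGroup V]
    [Module ℝ V] (b : AffineBasis ι ℝ V) (σ : Equiv.Perm ι) (i : ι) (x : V) :
    b.coord (σ i) (b.permMap σ x) = b.coord i x := by
  have h1 : b.permMap σ x = Finset.univ.affineCombination ℝ b (fun i => b.coord (σ.symm i) x) := by
    rw [Finset.affineCombination_eq_linear_combination]
    · refine (Equiv.sum_comp σ.symm fun i => b.coord i x • b (σ i)).symm.trans ?_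
      simp
    · rw [Equiv.sum_comp σ.symm fun i => b.coord i x]
      simp
  rw [h1, b.coord_apply_combination_of_mem (Finset.mem_univ _)]
  · simp
  · rw [Equiv.sum_comp σ.symm fun i => b.coord i x]
    simp

theorem AffineBasis.image_permMap {ι V : Type*} [Fintype ι] [AddCommGroup V]
    [Module ℝ V] (b : AffineBasis ι ℝ V) (σ : Equiv.Perm ι) :
    b.permMap σ '' convexHull ℝ (Set.range b) = convexHull ℝ (Set.range b) := by
  have key : ∀ τ : Equiv.Perm ι, ∀ x ∈ convexHull ℝ (Set.range b),
      b.permMap τ x ∈ convexHull ℝ (Set.range b) := by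
    intro τ x hx
    rw [b.convexHull_eq_nonneg_coord] at hx ⊢
    intro i
    have := b.coord_permMap τ (τ.symm i) x
    rw [Equiv.apply_symm_apply] at this
    rw [this]
    exact hx _
  apply Set.Subset.antisymm
  · rintro _ ⟨x, hx, rfl⟩
    exact key σ x hx
  · intro x hx
    refine ⟨b.permMap σ.symm x, key _ x hx, b.ext_elem fun i => ?_⟩
    have h1 := b.coord_permMap σ (σ.symm i) (b.permMap σ.symm x)
    have h2 := b.coord_permMap σ.symm i x
    rw [Equiv.apply_symm_apply] at h1
    rw [h1, h2]

theorem AffineBasis.isCompact_convexHull {ι V : Type*} [Finite ι] [NormedAddCommGroup V]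
    [NormedSpace ℝ V] (b : AffineBasis ι ℝ V) :
    IsCompact (convexHull ℝ (Set.range b)) :=
  (Set.finite_range b).isCompact_convexHull ℝ

theorem AffineBasis.measure_convexHull_pos {ι V : Type*} [Finite ι] [NormedAddCommGroup V]
    [NormedSpace ℝ V] [MeasurableSpace V] (b : AffineBasis ι ℝ V) (μ : Measure V)
    [μ.IsAddHaarMeasure] : 0 < μ (convexHull ℝ (Set.range b)) :=
  Measure.measure_pos_of_nonempty_interior _ <| by
    have := Fintype.ofFinite ι
    exact ⟨_, b.centroid_mem_interior_convexHull⟩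

variable {ι V F : Type*} [Fintype ι] [NormedAddCommGroup V] [NormedSpace ℝ V]
  [FiniteDimensional ℝ V] [MeasurableSpace V] [BorelSpace V]
  [NormedAddCommGroup F] [NormedSpace ℝ F]

/-- The affine map permuting the vertices sends the simplex onto itself and permutes the
coordinates. Its Jacobian need not be computed: the change of variables applied to the constant 1
forces it to be 1. -/
theorem AffineBasis.setIntegral_coord_perm (b : AffineBasis ι ℝ V) (μ : Measure V)
    [μ.IsAddHaarMeasure] (σ : Equiv.Perm ι) (i : ι) :
    ∫ x in convexHull ℝ (Set.range b), b.coord (σ i) x ∂μ =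
      ∫ x in convexHull ℝ (Set.range b), b.coord i x ∂μ := by
  set T := convexHull ℝ (Set.range b)
  have hT : IsCompact T := b.isCompact_convexHull
  set D : ℝ := |(LinearMap.toContinuousLinearMap (b.permMap σ).linear).det|
  have hinj : Set.InjOn (b.permMap σ) T := fun x _ y _ hxy => b.ext_elem fun j => by
    rw [← b.coord_permMap σ j x, ← b.coord_permMap σ j y, hxy]
  have hder : ∀ x ∈ T, HasFDerivWithinAt (b.permMap σ)
      (LinearMap.toContinuousLinearMap (b.permMap σ).linear) T x := by
    intro x _
    have h := (LinearMap.toContinuousLinearMap (b.permMap σ).linear).hasFDerivAt (x := x)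
    have h2 := (h.add_const (b.permMap σ 0)).hasFDerivWithinAt (s := T)
    refine h2.congr (fun y _ => ?_) ?_
    · exact congrFun (AffineMap.decomp (b.permMap σ)) y
    · exact congrFun (AffineMap.decomp (b.permMap σ)) x
  have change : ∀ g : V → ℝ, ∫ x in T, g x ∂μ = D * ∫ x in T, g (b.permMap σ x) ∂μ := by
    intro g
    have := integral_image_eq_integral_abs_det_fderiv_smul μ hT.measurableSet hder hinj g
    rw [b.image_permMap] at this
    rw [this, ← integral_const_mul]
    rfl
  have hD : D = 1 := by
    have h1 := change fun _ => 1
    simp only [integral_const, smul_eq_mul, mul_one] at h1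
    have h2 : (μ.restrict T).real Set.univ ≠ 0 := by
      simp only [measureReal_restrict_apply_univ]
      exact (ENNReal.toReal_pos (b.measure_convexHull_pos μ).ne' hT.measure_ne_top).ne'
    exact mul_right_cancel₀ h2 (by linarith)
  rw [change, hD, one_mul]
  simp_rw [b.coord_permMap]

/-- By symmetry all barycentric coordinates have the same integral, and they sum to 1, so each has
mean one over the number of vertices. -/
theorem AffineBasis.setAverage_convexHull [CompleteSpace F] (b : AffineBasis ι ℝ V) (μ : Measure V)
    [μ.IsAddHaarMeasure] (f : V →ᵃ[ℝ] F) :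
    ⨍ x in convexHull ℝ (Set.range b), f x ∂μ = (Fintype.card ι : ℝ)⁻¹ • ∑ i, f (b i) := by
  classical
  set T := convexHull ℝ (Set.range b)
  have hT : IsCompact T := b.isCompact_convexHull
  have hvol : μ.real T ≠ 0 :=
    (ENNReal.toReal_pos (b.measure_convexHull_pos μ).ne' hT.measure_ne_top).ne'
  have hint : ∀ i, IntegrableOn (b.coord i) T μ := fun i =>
    (continuous_barycentric_coord b i).continuousOn.integrableOn_compact hT
  have hconst : ∀ i j, ∫ x in T, b.coord i x ∂μ = ∫ x in T, b.coord j x ∂μ := fun i j => by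
    simpa using b.setIntegral_coord_perm μ (Equiv.swap j i) j
  have hsum : ∑ i, ∫ x in T, b.coord i x ∂μ = μ.real T := by
    rw [← integral_finsetSum _ fun i _ => hint i]
    simp
  have hcoord : ∀ i, ∫ x in T, b.coord i x ∂μ = (Fintype.card ι : ℝ)⁻¹ * μ.real T := by
    intro i
    have hne : (Fintype.card ι : ℝ) ≠ 0 := by
      have : Nonempty ι := ⟨i⟩
      exact_mod_cast Fintype.card_ne_zero
    rw [← hsum, Finset.sum_congr rfl fun j _ => hconst j i]
    simp [hne]
  have hf : ∀ x, f x = ∑ i, b.coord i x • f (b i) := b.apply_eq_sum_coord_smul f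
  rw [setAverage_eq, integral_congr_ae (Filter.Eventually.of_forall hf),
    integral_finsetSum _ fun i _ => (hint i).smul_const _]
  simp_rw [integral_smul_const, hcoord, Finset.smul_sum, smul_smul]
  refine Finset.sum_congr rfl fun i _ => ?_
  rw [mul_left_comm, inv_mul_cancel₀ hvol, mul_one]

/-- The affine span is parametrised isometrically by its direction space, where the k-dimensional
Hausdorff measure is a Haar measure and the full-dimensional result applies. -/
theorem AffineIndependent.setAverage_convexHull_euclideanHausdorff
    {E : Type*} [NormedAddCommGroup E] [InnerProductSpace ℝ E] [FiniteDimensional ℝ E]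
    [MeasurableSpace E] [BorelSpace E] [CompleteSpace F] {s : Finset E}
    (hs : AffineIndependent ℝ ((↑) : s → E)) {k : ℕ} (hk : s.card = k + 1) (f : E →ᵃ[ℝ] F) :
    ⨍ x in convexHull ℝ (s : Set E), f x ∂(μHE[k] : Measure E) =
      (s.card : ℝ)⁻¹ • ∑ p ∈ s, f p := by
  obtain ⟨p₀, hp₀⟩ : s.Nonempty := Finset.card_pos.1 (by omega)
  set W := vectorSpan ℝ (s : Set E)
  have hW : Module.finrank ℝ W = k := by
    have := hs.finrank_vectorSpan (n := k) (by simpa using hk)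
    rwa [Subtype.range_coe_subtype] at this
  let j : W →ᵃ[ℝ] E := W.subtype.toAffineMap + AffineMap.const ℝ W p₀
  have hj : ∀ w, j w = w + p₀ := fun w => rfl
  have hji : Isometry j := Isometry.of_dist_eq fun x y => by
    simp [hj, Subtype.dist_eq]
  let q : s → W := fun p => ⟨p - p₀, vsub_mem_vectorSpan ℝ p.2 hp₀⟩
  have hjq : ∀ p, j (q p) = p := fun p => by simp [hj, q]
  have hind : AffineIndependent ℝ q := by
    apply AffineIndependent.of_comp j
    have : ⇑j ∘ q = ((↑) : s → E) := funext hjq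
    rwa [this]
  let b : AffineBasis s ℝ W := ⟨q, hind, by
    rw [hind.affineSpan_eq_top_iff_card_eq_finrank_add_one, hW]
    simpa using hk⟩
  have himg : convexHull ℝ (s : Set E) = j '' convexHull ℝ (Set.range b) := by
    rw [AffineMap.image_convexHull, ← Set.range_comp]
    congr 1
    ext x
    simp only [Set.mem_range, Function.comp]
    constructor
    · intro hx
      exact ⟨⟨x, hx⟩, hjq _⟩
    · rintro ⟨y, rfl⟩
      change j (q y) ∈ _
      rw [hjq]
      exact y.2
  have hemb : MeasurableEmbedding j := hji.isClosedEmbedding.measurableEmbedding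
  have hint : ∀ g : E → F, ∫ x in convexHull ℝ (s : Set E), g x ∂(μHE[k] : Measure E) =
      ∫ w in convexHull ℝ (Set.range b), g (j w) ∂(μHE[k] : Measure W) := by
    intro g
    have h := hemb.setIntegral_map (μ := (μHE[k] : Measure W)) g (convexHull ℝ (s : Set E))
    rw [hji.map_euclideanHausdorffMeasure, himg, Set.preimage_image_eq _ hji.injective,
      Measure.restrict_restrict_of_subset (Set.image_subset_range _ _)] at h
    rw [himg]
    exact h
  have hmeas : (μHE[k] : Measure E).real (convexHull ℝ (s : Set E)) =
      (μHE[k] : Measure W).real (convexHull ℝ (Set.range b)) := by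
    rw [himg, Measure.real, Measure.real, hji.euclideanHausdorffMeasure_image]
  have : (μHE[k] : Measure W).IsAddHaarMeasure := by
    rw [← hW]
    infer_instance
  have hfin := b.setAverage_convexHull (μHE[k] : Measure W) (f.comp j)
  rw [setAverage_eq] at hfin ⊢
  rw [hint, hmeas]
  refine hfin.trans ?_
  have hc : Fintype.card s = s.card := by simp
  rw [hc]
  congr 1
  rw [← Finset.sum_coe_sort s]
  refine Finset.sum_congr rfl fun p _ => ?_
  change f (j (q p)) = _
  rw [hjq]

end SimplexAverage

/-! ### Barycentric coordinates: divergence formula, facet areas. -/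

section SimplexGeometry

open MeasureTheory

theorem AffineBasis.linear_eq_sum_smul {ι V F : Type*} [Fintype ι] [AddCommGroup V]
    [Module ℝ V] [AddCommGroup F] [Module ℝ F] (b : AffineBasis ι ℝ V) (f : V →ᵃ[ℝ] F) (w : V) :
    f.linear w = ∑ i, (b.coord i).linear w • f (b i) := by
  have h1 := b.apply_eq_sum_coord_smul f (w +ᵥ (0 : V))
  rw [AffineMap.map_vadd, vadd_eq_add, b.apply_eq_sum_coord_smul f 0] at h1
  simp_rw [AffineMap.map_vadd, vadd_eq_add, add_smul, Finset.sum_add_distrib] at h1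
  exact add_right_cancel h1

theorem AffineBasis.sum_coord_linear {ι V : Type*} [Fintype ι] [AddCommGroup V]
    [Module ℝ V] (b : AffineBasis ι ℝ V) (w : V) : ∑ i, (b.coord i).linear w = 0 := by
  simpa using (b.linear_eq_sum_smul (AffineMap.const ℝ V (1 : ℝ)) w).symm

/-- Integration by parts on a simplex, written in barycentric coordinates. -/
theorem AffineBasis.linear_add_trace_mul {ι V : Type*} [Fintype ι] [AddCommGroup V]
    [Module ℝ V] (b : AffineBasis ι ℝ V) (y : V →ᵃ[ℝ] V) (v : V →ᵃ[ℝ] ℝ) (r : ι → ℝ)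
    (h : ∀ i j, j ≠ i → (b.coord i).linear (y (b j)) = r i) :
    v.linear ((Fintype.card ι : ℝ)⁻¹ • ∑ j, y (b j)) +
        LinearMap.trace ℝ V y.linear * ((Fintype.card ι : ℝ)⁻¹ * ∑ j, v (b j)) =
      -∑ i, r i * (∑ j, v (b j) - v (b i)) := by
  classical
  have hN : (Fintype.card ι : ℝ) ≠ 0 := by
    have := b.nonempty
    exact_mod_cast Fintype.card_ne_zero
  have : FiniteDimensional ℝ V := b.finiteDimensional
  set N : ℝ := (Fintype.card ι : ℝ)
  set R := ∑ i, r i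
  -- The hypothesis fixes the off-diagonal entries of the matrix with entries `(b.coord i).linear (y
  -- (b j))`. Its columns sum to zero, which determines the diagonal.
  have hdiag : ∀ j, (b.coord j).linear (y (b j)) = r j - R := by
    intro j
    have h0 := b.sum_coord_linear (y (b j))
    rw [← Finset.add_sum_erase _ _ (Finset.mem_univ j),
      Finset.sum_congr rfl fun i hi => h i j (Finset.ne_of_mem_erase hi).symm] at h0
    have h1 : r j + ∑ i ∈ Finset.univ.erase j, r i = R := Finset.add_sum_erase _ _ (Finset.mem_univ j)
    linarith
  have hrow : ∀ i, (b.coord i).linear (∑ j, y (b j)) = N * r i - R := by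
    intro i
    rw [map_sum, ← Finset.add_sum_erase _ _ (Finset.mem_univ i), hdiag,
      Finset.sum_congr rfl fun j hj => h i j (Finset.ne_of_mem_erase hj)]
    rw [Finset.sum_const, Finset.card_erase_of_mem (Finset.mem_univ i), Finset.card_univ,
      nsmul_eq_mul, Nat.cast_sub (Fintype.card_pos_iff.2 ⟨i⟩)]
    push_cast
    ring
  have htr : LinearMap.trace ℝ V y.linear = R - N * R := by
    have : y.linear = ∑ i, (b.coord i).linear.smulRight (y (b i)) := by
      ext w
      rw [b.linear_eq_sum_smul y w]
      simp only [LinearMap.sum_apply, LinearMap.smulRight_apply]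
    rw [this, map_sum]
    simp_rw [LinearMap.trace_smulRight, hdiag]
    simp [R, N]
  have hv : v.linear (∑ j, y (b j)) = ∑ i, (N * r i - R) * v (b i) := by
    rw [b.linear_eq_sum_smul v]
    simp_rw [hrow, smul_eq_mul]
  rw [map_smul, hv, htr]
  simp_rw [sub_mul, mul_sub, Finset.sum_sub_distrib, ← Finset.sum_mul, ← Finset.mul_sum, mul_assoc,
    smul_eq_mul]
  rw [← Finset.mul_sum]
  field_simp
  ring

theorem AffineBasis.coord_homothety_self {ι E : Type*} [AddCommGroup E] [Module ℝ E]
    (b : AffineBasis ι ℝ E) (i : ι) (t : ℝ) (x : E) :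
    b.coord i (AffineMap.homothety (b i) t x) = 1 - t + t * b.coord i x := by
  rw [AffineMap.homothety_eq_lineMap, AffineMap.apply_lineMap, AffineMap.lineMap_apply]
  simp
  ring

theorem AffineBasis.coord_homothety_of_ne {ι E : Type*} [AddCommGroup E] [Module ℝ E]
    (b : AffineBasis ι ℝ E) {i j : ι} (h : j ≠ i) (t : ℝ)
    (x : E) : b.coord j (AffineMap.homothety (b i) t x) = t * b.coord j x := by
  rw [AffineMap.homothety_eq_lineMap, AffineMap.apply_lineMap, AffineMap.lineMap_apply]
  simp [h]

/-- The facet of a simplex opposite to the point `b i`. -/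
def AffineBasis.facet {ι E : Type*} [AddCommGroup E] [Module ℝ E]
    (b : AffineBasis ι ℝ E) (i : ι) : Set E :=
  {x | (∀ j, 0 ≤ b.coord j x) ∧ b.coord i x = 0}

/-- Slices of the simplex parallel to a facet are copies of the facet shrunk towards the opposite
vertex. -/
theorem AffineBasis.homothety_image_facet {ι E : Type*} [AddCommGroup E] [Module ℝ E]
    (b : AffineBasis ι ℝ E) (i : ι) {t : ℝ} (ht : 0 < t)
    (ht1 : t ≤ 1) : AffineMap.homothety (b i) t '' b.facet i =
      {x | (∀ j, 0 ≤ b.coord j x) ∧ b.coord i x = 1 - t} := by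
  ext x
  constructor
  · rintro ⟨s, ⟨hs, hs0⟩, rfl⟩
    have hi : b.coord i (AffineMap.homothety (b i) t s) = 1 - t := by
      rw [b.coord_homothety_self, hs0]; ring
    refine ⟨fun j => ?_, hi⟩
    by_cases hj : j = i
    · subst hj
      rw [hi]; linarith
    · rw [b.coord_homothety_of_ne hj]
      exact mul_nonneg ht.le (hs j)
  · rintro ⟨hx, hxi⟩
    have hi : b.coord i (AffineMap.homothety (b i) t⁻¹ x) = 0 := by
      rw [b.coord_homothety_self, hxi]
      field_simp
      ring
    refine ⟨AffineMap.homothety (b i) t⁻¹ x, ⟨fun j => ?_, hi⟩, ?_⟩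
    · by_cases hj : j = i
      · subst hj
        exact hi.ge
      · rw [b.coord_homothety_of_ne hj]
        exact mul_nonneg (inv_pos.2 ht).le (hx j)
    · rw [← AffineMap.comp_apply, ← AffineMap.homothety_mul, mul_inv_cancel₀ ht.ne']
      simp

variable {ι E : Type*} [NormedAddCommGroup E] [InnerProductSpace ℝ E] [FiniteDimensional ℝ E]

/-- The gradient of an affine function. -/
noncomputable def AffineMap.grad (v : E →ᵃ[ℝ] ℝ) : E :=
  (InnerProductSpace.toDual ℝ E).symm (LinearMap.toContinuousLinearMap v.linear)

theorem AffineMap.inner_grad (v : E →ᵃ[ℝ] ℝ) (w : E) : inner ℝ v.grad w = v.linear w := by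
  simp [AffineMap.grad]

theorem AffineMap.gradient_eq_grad (v : E →ᵃ[ℝ] ℝ) (x : E) :
    gradient (fun z => v z) x = v.grad := by
  have h := ((LinearMap.toContinuousLinearMap v.linear).hasFDerivAt (x := x)).add_const (v 0)
  have h2 : HasFDerivAt (fun z => v z) (LinearMap.toContinuousLinearMap v.linear) x := by
    refine h.congr_of_eventuallyEq (Filter.Eventually.of_forall fun z => ?_)
    exact congrFun (AffineMap.decomp v) z
  rw [gradient, h2.fderiv, AffineMap.grad]

theorem AffineBasis.grad_coord_ne_zero [Nontrivial ι] (b : AffineBasis ι ℝ E) (i : ι) :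
    (b.coord i).grad ≠ 0 := by
  intro h
  obtain ⟨j, hj⟩ := exists_ne i
  have h1 := (b.coord i).inner_grad (b i -ᵥ b j)
  rw [h, inner_zero_left, AffineMap.linearMap_vsub, b.coord_apply_eq, b.coord_apply_ne hj.symm] at h1
  simp at h1

/-- Cavalieri for the cone with apex `b i`: the slice at `coord i = 1 - t` is the facet scaled by t,
the integral of t^k over [0,1] is 1/(k+1), and the height is the inverse norm of the gradient. -/
theorem AffineBasis.volume_convexHull_eq [Fintype ι] [Nontrivial ι] [MeasurableSpace E]
    [BorelSpace E] (b : AffineBasis ι ℝ E) (i : ι) {k : ℕ} (hk : Module.finrank ℝ E = k + 1) :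
    volume (convexHull ℝ (Set.range b)) =
      ENNReal.ofReal ‖(b.coord i).grad‖⁻¹ *
        (ENNReal.ofReal ((k : ℝ) + 1)⁻¹ * (μHE[k] : Measure E) (b.facet i)) := by
  set ℓ := (b.coord i).grad
  have hℓ : ℓ ≠ 0 := b.grad_coord_ne_zero i
  have hℓn : ‖ℓ‖ ≠ 0 := norm_ne_zero_iff.2 hℓ
  set v : E := -(‖ℓ‖ ^ 2)⁻¹ • ℓ with hv
  have hv0 : v ≠ 0 := by simp [hv, hℓ]
  have hvn : ‖v‖ₑ = ENNReal.ofReal ‖ℓ‖⁻¹ := by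
    rw [← ofReal_norm, hv, norm_smul]
    congr 1
    rw [norm_neg, norm_inv, norm_pow, norm_norm]
    field_simp
  have hlv : inner ℝ ℓ v = -1 := by
    rw [hv, inner_smul_right, real_inner_self_eq_norm_sq]
    field_simp
  have hslice : ∀ t : ℝ, convexHull ℝ (Set.range b) ∩
      AffineSubspace.mk' (t • v +ᵥ b i) (Submodule.span ℝ {v})ᗮ =
      {x | (∀ j, 0 ≤ b.coord j x) ∧ b.coord i x = 1 - t} := by
    intro t
    rw [b.convexHull_eq_nonneg_coord]
    ext x
    have hx : b.coord i x = 1 + inner ℝ ℓ (x - b i) := by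
      rw [AffineMap.inner_grad, ← vsub_eq_sub, AffineMap.linearMap_vsub, b.coord_apply_eq]
      simp
    have hmem : x ∈ (AffineSubspace.mk' (t • v +ᵥ b i) (Submodule.span ℝ {v})ᗮ : Set E) ↔
        b.coord i x = 1 - t := by
      rw [SetLike.mem_coe, AffineSubspace.mem_mk', Submodule.mem_orthogonal_singleton_iff_inner_right,
        vsub_eq_sub, vadd_eq_add]
      have h1 : inner ℝ v (x - (t • v + b i)) =
          -(‖ℓ‖ ^ 2)⁻¹ * (inner ℝ ℓ (x - b i) + t) := by
        conv_lhs => rw [hv, inner_smul_left]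
        rw [show x - (t • v + b i) = (x - b i) - t • v by abel, inner_sub_right, inner_smul_right,
          hlv]
        simp
      rw [h1, hx]
      have : -(‖ℓ‖ ^ 2)⁻¹ ≠ 0 := by simp [hℓ]
      rw [mul_eq_zero, or_iff_right this]
      constructor <;> intro h <;> linarith
    rw [Set.mem_inter_iff, hmem]
    rfl
  have hmeas : MeasurableSet (convexHull ℝ (Set.range b)) := b.isCompact_convexHull.measurableSet
  rw [← InnerProductSpace.euclideanHausdorffMeasure_eq_volume,
    EuclideanGeometry.euclideanHausdorffMeasure_eq_lintegral (b i) hv0 hmeas, hvn]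
  congr 1
  simp_rw [hslice, hk, Nat.add_sub_cancel]
  have hF : (fun t : ℝ => (μHE[k] : Measure E)
      {x | (∀ j, 0 ≤ b.coord j x) ∧ b.coord i x = 1 - t}) =ᵐ[volume]
      (Set.Ioc (0 : ℝ) 1).indicator
        fun t => ENNReal.ofReal (t ^ k) * (μHE[k] : Measure E) (b.facet i) := by
    -- At t = 0 the slice is the apex alone, which has positive measure when k = 0.
    have h0 : ∀ᵐ t : ℝ, t ≠ 0 := by simp [ae_iff]
    filter_upwards [h0] with t ht
    by_cases h : t ∈ Set.Ioc (0 : ℝ) 1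
    · rw [Set.indicator_of_mem h, ← b.homothety_image_facet i h.1 h.2,
        euclideanHausdorffMeasure_homothety_image k (b i) ht]
      rw [ENNReal.smul_def, smul_eq_mul, ENNReal.ofReal_pow h.1.le]
      congr 1
      rw [ENNReal.coe_pow, ← enorm_eq_nnnorm, Real.enorm_of_nonneg h.1.le]
    · rw [Set.indicator_of_notMem h]
      refine measure_mono_null (Set.eq_empty_iff_forall_notMem.2 ?_).subset measure_empty
      rintro x ⟨hx, hxi⟩
      apply h
      have h1 : b.coord i x ≤ 1 := by
        rw [← b.sum_coord_apply_eq_one x]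
        exact Finset.single_le_sum (f := fun j => b.coord j x) (fun j _ => hx j) (Finset.mem_univ i)
      have h2 := hx i
      exact ⟨lt_of_le_of_ne (by linarith) ht.symm, by linarith⟩
  rw [lintegral_congr_ae hF, lintegral_indicator measurableSet_Ioc, lintegral_mul_const _ (by fun_prop)]
  congr 1
  rw [← ofReal_integral_eq_lintegral_ofReal, ← intervalIntegral.integral_of_le zero_le_one]
  · simp
  · exact ((continuous_pow k).continuousOn.integrableOn_compact isCompact_Icc).mono_set
      Set.Ioc_subset_Icc_self
  · filter_upwards [ae_restrict_mem measurableSet_Ioc] with t ht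
    exact pow_nonneg ht.1.le k

theorem AffineBasis.euclideanHausdorffMeasure_facet [Fintype ι] [Nontrivial ι] [MeasurableSpace E]
    [BorelSpace E] (b : AffineBasis ι ℝ E) (i : ι) {k : ℕ} (hk : Module.finrank ℝ E = k + 1) :
    (μHE[k] : Measure E).real (b.facet i) =
      (k + 1) * volume.real (convexHull ℝ (Set.range b)) * ‖(b.coord i).grad‖ := by
  have hℓn : ‖(b.coord i).grad‖ ≠ 0 := norm_ne_zero_iff.2 (b.grad_coord_ne_zero i)
  rw [Measure.real, Measure.real, b.volume_convexHull_eq i hk, ENNReal.toReal_mul,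
    ENNReal.toReal_mul, ENNReal.toReal_ofReal (by positivity), ENNReal.toReal_ofReal (by positivity)]
  have : (k : ℝ) + 1 ≠ 0 := by positivity
  field_simp

end SimplexGeometry

/-! ### Elements and their sides in barycentric coordinates. -/

namespace Mesh

open MeasureTheory

noncomputable section

variable {d : ℕ} {Ω : Set (Eucl d)} {𝒯 : Mesh d Ω}

/-- The vertices of an element as an affine basis. -/
def Elem.basis (T : 𝒯.Elem) : AffineBasis T.1 ℝ (Eucl d) :=
  ⟨(↑), 𝒯.indep T.2.1, by
    rw [(𝒯.indep T.2.1).affineSpan_eq_top_iff_card_eq_finrank_add_one]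
    simp [T.2.2]⟩

@[simp]
theorem Elem.basis_apply (T : 𝒯.Elem) (i : T.1) : T.basis i = (i : Eucl d) := rfl

theorem Elem.range_basis (T : 𝒯.Elem) : Set.range T.basis = (T.1 : Set (Eucl d)) :=
  Subtype.range_coe_subtype

theorem Elem.carrier_eq (T : 𝒯.Elem) : T.carrier = convexHull ℝ (Set.range T.basis) := by
  rw [T.range_basis, Elem.carrier]

theorem Elem.vol_pos (T : 𝒯.Elem) : 0 < T.vol := by
  rw [Elem.vol, T.carrier_eq]
  exact ENNReal.toReal_pos (T.basis.measure_convexHull_pos volume).ne'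
    T.basis.isCompact_convexHull.measure_ne_top

/-- The mean value of a function over the points of a finite set. -/
def vertexMean {F : Type*} [AddCommGroup F] [Module ℝ F] (s : Finset (Eucl d)) (v : Eucl d → F) :
    F :=
  (s.card : ℝ)⁻¹ • ∑ p ∈ s, v p

/-- With this, means over elements and sides, barycentre values and vertex averages of affine
functions become interchangeable. -/
theorem apply_centroid {F : Type*} [AddCommGroup F] [Module ℝ F] {s : Finset (Eucl d)}
    (hs : s.Nonempty) (v : Eucl d →ᵃ[ℝ] F) : v (s.centroid ℝ id) = vertexMean s v := by
  have h1 := s.sum_centroidWeights_eq_one_of_nonempty ℝ hs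
  rw [Finset.centroid_def, Finset.map_affineCombination _ _ _ h1,
    Finset.affineCombination_eq_linear_combination _ _ _ h1, vertexMean, Finset.smul_sum]
  rfl

theorem Elem.setAverage_eq {F : Type*} [NormedAddCommGroup F] [NormedSpace ℝ F] [CompleteSpace F]
    (T : 𝒯.Elem) (v : Eucl d →ᵃ[ℝ] F) : ⨍ x in T.carrier, v x = vertexMean T.1 v := by
  rw [T.carrier_eq, T.basis.setAverage_convexHull, vertexMean, Fintype.card_coe]
  congr 1
  exact Finset.sum_coe_sort T.1 v

theorem proj_eq (v : 𝒯.L1) (T : 𝒯.Elem) : proj v T = vertexMean T.1 (v T) := T.setAverage_eq _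

theorem projVec_eq (y : 𝒯.L1Vec) (T : 𝒯.Elem) : projVec y T = vertexMean T.1 (y T) :=
  T.setAverage_eq _

theorem grad_eq (v : 𝒯.L1) (T : 𝒯.Elem) : grad v T = (v T).grad := (v T).gradient_eq_grad _

theorem Side.setAverage_eq {F : Type*} [NormedAddCommGroup F] [NormedSpace ℝ F] [CompleteSpace F]
    (hd : 1 ≤ d) (S : 𝒯.Side) (v : Eucl d →ᵃ[ℝ] F) :
    ⨍ x in S.carrier, v x ∂(surf d) = vertexMean S.1 v :=
  (𝒯.indep S.2.1).setAverage_convexHull_euclideanHausdorff (by rw [S.2.2]; omega) v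

theorem sideProj_eq (hd : 1 ≤ d) (v : 𝒯.L1) (S : 𝒯.Side) :
    sideProj v S = vertexMean S.1 (v S.elem) := S.setAverage_eq hd _

theorem Elem.nontrivial (hd : 1 ≤ d) (T : 𝒯.Elem) : Nontrivial T.1 := by
  rw [← Fintype.one_lt_card_iff_nontrivial, Fintype.card_coe, T.2.2]
  omega

theorem Side.nonempty (S : 𝒯.Side) : S.1.Nonempty := 𝒯.nonempty_of_mem_faces S.2.1

theorem Elem.nonempty (T : 𝒯.Elem) : T.1.Nonempty := 𝒯.nonempty_of_mem_faces T.2.1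

open Classical in
/-- The side of an element opposite to a vertex. -/
def Elem.side (hd : 1 ≤ d) (T : 𝒯.Elem) (i : T.1) : 𝒯.Side :=
  ⟨T.1.erase i, 𝒯.down_closed T.2.1 (Finset.erase_subset _ _) (Finset.card_pos.1 (by
    rw [Finset.card_erase_of_mem i.2, T.2.2]; omega)), by
    rw [Finset.card_erase_of_mem i.2, T.2.2]; omega⟩

theorem Elem.side_isSideOf (hd : 1 ≤ d) (T : 𝒯.Elem) (i : T.1) : (T.side hd i).IsSideOf T := by
  classical
  exact Finset.erase_subset _ _

theorem Elem.mem_side (hd : 1 ≤ d) (T : 𝒯.Elem) (i j : T.1) :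
    (j : Eucl d) ∈ (T.side hd i).1 ↔ j ≠ i := by
  classical
  simp [Elem.side]

theorem Elem.side_injective (hd : 1 ≤ d) (T : 𝒯.Elem) : Function.Injective (T.side hd) := by
  intro i j h
  by_contra hij
  have h1 := (T.mem_side hd j i).2 hij
  rw [← h] at h1
  exact (T.mem_side hd i i).1 h1 rfl

theorem Side.IsSideOf.exists_eq_side (hd : 1 ≤ d) {S : 𝒯.Side} {T : 𝒯.Elem} (h : S.IsSideOf T) :
    ∃ i, S = T.side hd i := by
  classical
  obtain ⟨p, hp⟩ : (T.1 \ S.1).Nonempty := by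
    rw [← Finset.card_pos, Finset.card_sdiff_of_subset h, S.2.2, T.2.2]; omega
  rw [Finset.mem_sdiff] at hp
  refine ⟨⟨p, hp.1⟩, Subtype.ext ?_⟩
  refine Finset.eq_of_subset_of_card_le (fun x hx => Finset.mem_erase.2 ⟨?_, h hx⟩) ?_
  · rintro rfl
    exact hp.2 hx
  · rw [(T.side hd _).2.2, S.2.2]

open Classical in
/-- The sides of an element. -/
def Elem.sides (T : 𝒯.Elem) : Finset 𝒯.Side := {S | S.IsSideOf T}

theorem Elem.mem_sides {T : 𝒯.Elem} {S : 𝒯.Side} : S ∈ T.sides ↔ S.IsSideOf T := by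
  simp [Elem.sides]

theorem Elem.sum_sides {F : Type*} [AddCommMonoid F] (hd : 1 ≤ d) (T : 𝒯.Elem) (G : 𝒯.Side → F) :
    ∑ S ∈ T.sides, G S = ∑ i, G (T.side hd i) := by
  refine (Finset.sum_bij (fun i _ => T.side hd i) (fun i _ => ?_) (fun i _ j _ h => ?_)
    (fun S hS => ?_) fun _ _ => rfl).symm
  · exact Elem.mem_sides.2 (T.side_isSideOf hd i)
  · exact T.side_injective hd h
  · obtain ⟨i, rfl⟩ := (Elem.mem_sides.1 hS).exists_eq_side hd
    exact ⟨i, Finset.mem_univ _, rfl⟩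

theorem Elem.sum_side (hd : 1 ≤ d) (T : 𝒯.Elem) (i : T.1) {F : Type*} [AddCommGroup F]
    (v : Eucl d → F) : ∑ p ∈ (T.side hd i).1, v p = ∑ j : T.1, v j - v i := by
  classical
  rw [eq_sub_iff_add_eq, Finset.sum_coe_sort T.1 v]
  exact Finset.sum_erase_add _ _ i.2

theorem Elem.mem_carrier {T : 𝒯.Elem} {x : Eucl d} :
    x ∈ T.carrier ↔ ∀ j, 0 ≤ T.basis.coord j x := by
  rw [T.carrier_eq, T.basis.convexHull_eq_nonneg_coord]
  rfl

theorem Elem.side_carrier (hd : 1 ≤ d) (T : 𝒯.Elem) (i : T.1) :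
    (T.side hd i).carrier = T.basis.facet i := by
  classical
  ext x
  constructor
  · intro hx
    refine ⟨Elem.mem_carrier.1 (convexHull_mono (T.side_isSideOf hd i) hx), ?_⟩
    have hconv : Convex ℝ {x | T.basis.coord i x = 0} := by
      have := (convex_singleton (0 : ℝ)).affine_preimage (T.basis.coord i)
      exact this
    refine convexHull_min (s := ((T.side hd i).1 : Set (Eucl d))) (fun p hp => ?_) hconv hx
    have hp' : p ∈ T.1 := T.side_isSideOf hd i hp
    have h1 := T.basis.coord_apply_ne ((T.mem_side hd i ⟨p, hp'⟩).1 hp).symm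
    rw [Elem.basis_apply] at h1
    exact h1
  · rintro ⟨hx, hxi⟩
    have h1 := T.basis.linear_combination_coord_eq_self x
    have h2 := T.basis.sum_coord_apply_eq_one x
    rw [← Finset.sum_erase _ (a := i) (by rw [hxi, zero_smul])] at h1
    rw [← Finset.sum_erase _ (a := i) hxi] at h2
    rw [← h1]
    refine (convex_convexHull ℝ _).sum_mem (fun j _ => hx j) h2 fun j hj => ?_
    exact subset_convexHull _ _ ((T.mem_side hd i j).2 (Finset.ne_of_mem_erase hj))

/-- This makes the gradient of the opposite coordinate a normal to the side. For the converse, the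
coordinate differentials sum to zero, so x is a combination of differences of vertices with a fixed
vertex q of the side. -/
theorem Elem.mem_vectorSpan_side (hd : 1 ≤ d) (T : 𝒯.Elem) (i : T.1) (x : Eucl d) :
    x ∈ vectorSpan ℝ ((T.side hd i).1 : Set (Eucl d)) ↔ (T.basis.coord i).linear x = 0 := by
  classical
  constructor
  · intro hx
    have : vectorSpan ℝ ((T.side hd i).1 : Set (Eucl d)) ≤
        LinearMap.ker (T.basis.coord i).linear := by
      rw [vectorSpan, Submodule.span_le]
      rintro _ ⟨p, hp, q, hq, rfl⟩
      have hpT := T.side_isSideOf hd i hp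
      have hqT := T.side_isSideOf hd i hq
      have h1 := T.basis.coord_apply_ne ((T.mem_side hd i ⟨p, hpT⟩).1 hp).symm
      have h2 := T.basis.coord_apply_ne ((T.mem_side hd i ⟨q, hqT⟩).1 hq).symm
      simp only [Elem.basis_apply] at h1 h2
      simp only [SetLike.mem_coe, LinearMap.mem_ker]
      rw [AffineMap.linearMap_vsub, h1, h2]
      simp
    exact this hx
  · intro hx
    obtain ⟨q, hq⟩ := (T.side hd i).nonempty
    have h1 := T.basis.linear_eq_sum_smul (AffineMap.id ℝ (Eucl d)) x
    have h2 := T.basis.sum_coord_linear x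
    simp only [AffineMap.id_linear, LinearMap.id_apply, AffineMap.id_apply] at h1
    have h3 : x = ∑ j, (T.basis.coord j).linear x • (T.basis j -ᵥ q) := by
      simp_rw [vsub_eq_sub, smul_sub, Finset.sum_sub_distrib, ← Finset.sum_smul, h2, zero_smul,
        sub_zero]
      exact h1
    rw [h3]
    refine Submodule.sum_mem _ fun j _ => ?_
    by_cases hj : j = i
    · rw [hj, hx, zero_smul]
      exact Submodule.zero_mem _
    · exact Submodule.smul_mem _ _ (vsub_mem_vectorSpan ℝ ((T.mem_side hd i j).2 hj) hq)

theorem Elem.coord_centroid_side (hd : 1 ≤ d) (T : 𝒯.Elem) (i j : T.1) :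
    T.basis.coord j ((T.side hd i).1.centroid ℝ id) = if j = i then 0 else (d : ℝ)⁻¹ := by
  classical
  rw [apply_centroid (T.side hd i).nonempty, vertexMean, (T.side hd i).2.2,
    T.sum_side hd i (T.basis.coord j)]
  have h1 : ∀ k : T.1, T.basis.coord j (k : Eucl d) = if j = k then 1 else 0 :=
    fun k => T.basis.coord_apply j k
  simp_rw [h1]
  by_cases h : j = i <;> simp [h]

theorem Elem.coord_centroid (T : 𝒯.Elem) (j : T.1) :
    T.basis.coord j (T.1.centroid ℝ id) = ((d : ℝ) + 1)⁻¹ := by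
  classical
  rw [apply_centroid T.nonempty, vertexMean, T.2.2, ← Finset.sum_coe_sort]
  have h1 : ∀ k : T.1, T.basis.coord j (k : Eucl d) = if j = k then 1 else 0 :=
    fun k => T.basis.coord_apply j k
  simp_rw [h1]
  simp

/-- The barycentre-to-barycentre vector pairs with the coordinate gradient to -1/(d+1), so its
projection orthogonal to the side is a negative multiple of that gradient. -/
theorem Elem.normal_side (hd : 1 ≤ d) (T : 𝒯.Elem) (i : T.1) :
    normal T (T.side hd i) = -(‖(T.basis.coord i).grad‖⁻¹ • (T.basis.coord i).grad) := by
  have := T.nontrivial hd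
  set ℓ := (T.basis.coord i).grad with hℓ
  have hℓ0 : ℓ ≠ 0 := T.basis.grad_coord_ne_zero i
  set w := (T.side hd i).1.centroid ℝ id - T.1.centroid ℝ id with hw
  have hlw : inner ℝ ℓ w = -((d : ℝ) + 1)⁻¹ := by
    rw [hℓ, AffineMap.inner_grad, hw, ← vsub_eq_sub, AffineMap.linearMap_vsub,
      T.coord_centroid_side, T.coord_centroid]
    simp
  have hproj : (vectorSpan ℝ ((T.side hd i).1 : Set (Eucl d)))ᗮ.starProjection w =
      (inner ℝ ℓ w / ‖ℓ‖ ^ 2) • ℓ := by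
    apply Submodule.eq_starProjection_of_mem_orthogonal
    · refine Submodule.smul_mem _ _ ((Submodule.mem_orthogonal' _ _).2 fun x hx => ?_)
      rw [hℓ, AffineMap.inner_grad]
      exact (T.mem_vectorSpan_side hd i x).1 hx
    · rw [Submodule.orthogonal_orthogonal, T.mem_vectorSpan_side, ← AffineMap.inner_grad, ← hℓ,
        inner_sub_right, inner_smul_right, real_inner_self_eq_norm_sq]
      have : ‖ℓ‖ ≠ 0 := norm_ne_zero_iff.2 hℓ0
      field_simp
      ring
  rw [normal, ← hw, hproj, NormedSpace.normalize_smul_of_neg, NormedSpace.normalize]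
  rw [hlw]
  have : 0 < ‖ℓ‖ := norm_pos_iff.2 hℓ0
  exact div_neg_of_neg_of_pos (neg_neg_of_pos (by positivity)) (by positivity)

theorem Elem.area_side (hd : 1 ≤ d) (T : 𝒯.Elem) (i : T.1) :
    (T.side hd i).area = d * T.vol * ‖(T.basis.coord i).grad‖ := by
  have := T.nontrivial hd
  have h := T.basis.euclideanHausdorffMeasure_facet i (k := d - 1) (by simp; omega)
  rw [← T.side_carrier hd, ← T.carrier_eq] at h
  rw [Side.area, surf, h, Elem.vol]
  congr 3
  rw [Nat.cast_sub hd]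
  simp

theorem Side.area_pos (hd : 1 ≤ d) (S : 𝒯.Side) : 0 < S.area := by
  obtain ⟨T, hT⟩ := S.exists_isSideOf
  obtain ⟨i, rfl⟩ := hT.exists_eq_side hd
  have := T.nontrivial hd
  rw [T.area_side]
  have h1 : (0 : ℝ) < d := by exact_mod_cast hd
  have h2 := norm_pos_iff.2 (T.basis.grad_coord_ne_zero i)
  have h3 := T.vol_pos
  positivity

/-- Integration by parts on an element for fields with constant normal components on sides. -/
theorem Elem.integration_by_parts (hd : 1 ≤ d) (T : 𝒯.Elem) (y : 𝒯.L1Vec) (v : 𝒯.L1)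
    (c : 𝒯.Side → ℝ)
    (hc : ∀ S : 𝒯.Side, S.IsSideOf T → ∀ x ∈ S.carrier, inner ℝ (y T x) (normal T S) = c S) :
    T.vol * inner ℝ (grad v T) (projVec y T) + T.vol * (div y T * proj v T) =
      ∑ S ∈ T.sides, S.area * (c S * vertexMean S.1 (v T)) := by
  have := T.nontrivial hd
  have hd0 : (d : ℝ) ≠ 0 := by
    have : d ≠ 0 := by omega
    exact_mod_cast this
  -- Since the outward normal is minus the normalised gradient, a normal component c means that the
  -- differential of the opposite coordinate takes the value -‖grad‖ c. The area d · vol · ‖grad‖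
  -- then absorbs all factors.
  have key := T.basis.linear_add_trace_mul (y T) (v T)
    (fun i => -(‖(T.basis.coord i).grad‖ * c (T.side hd i))) ?_
  · rw [T.sum_sides hd, grad_eq, AffineMap.inner_grad, projVec_eq, proj_eq, div, ← mul_add]
    rw [Fintype.card_coe] at key
    have e1 : vertexMean T.1 (y T) = (T.1.card : ℝ)⁻¹ • ∑ j, y T (T.basis j) := by
      rw [vertexMean, ← Finset.sum_coe_sort T.1]; rfl
    have e2 : vertexMean T.1 (v T) = (T.1.card : ℝ)⁻¹ * ∑ j, v T (T.basis j) := by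
      rw [vertexMean, ← Finset.sum_coe_sort T.1]; rfl
    rw [e1, e2, key, ← Finset.sum_neg_distrib, Finset.mul_sum]
    refine Finset.sum_congr rfl fun i _ => ?_
    rw [T.area_side, vertexMean, (T.side hd i).2.2, T.sum_side, smul_eq_mul]
    simp only [Elem.basis_apply]
    field_simp
  · intro i j hj
    have hmem : (j : Eucl d) ∈ (T.side hd i).carrier :=
      subset_convexHull _ _ ((T.mem_side hd i j).2 hj)
    have h1 := hc _ (T.side_isSideOf hd i) _ hmem
    have h2 : ‖(T.basis.coord i).grad‖ ≠ 0 := norm_ne_zero_iff.2 (T.basis.grad_coord_ne_zero i)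
    rw [T.normal_side, inner_neg_right, inner_smul_right, real_inner_comm,
      AffineMap.inner_grad] at h1
    rw [← h1, Elem.basis_apply]
    field_simp

/-! ### Adjacency of elements and boundary sides. -/

open Filter Topology

/-- Simplices of the complex meet in the hull of their common vertices, where this coordinate
vanishes. -/
theorem Elem.coord_eq_zero_of_notMem {T T' : 𝒯.Elem} {j : T.1} (hj : (j : Eucl d) ∉ T'.1)
    {x : Eucl d} (hx : x ∈ T.carrier) (hx' : x ∈ T'.carrier) : T.basis.coord j x = 0 := by
  have hmem := 𝒯.inter_subset_convexHull T.2.1 T'.2.1 ⟨hx, hx'⟩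
  have hconv : Convex ℝ {x | T.basis.coord j x = 0} :=
    (convex_singleton (0 : ℝ)).affine_preimage (T.basis.coord j)
  refine convexHull_min (s := (T.1 ∩ T'.1 : Set (Eucl d))) (fun p hp => ?_) hconv hmem
  have hne : j ≠ ⟨p, hp.1⟩ := by
    rintro rfl
    exact hj hp.2
  have h1 := T.basis.coord_apply_ne hne
  rw [Elem.basis_apply] at h1
  exact h1

theorem Elem.vertex_notMem (hd : 1 ≤ d) {T T' : 𝒯.Elem} (hne : T ≠ T') {i : T.1} {i' : T'.1}
    (h : T.side hd i = T'.side hd i') : (i : Eucl d) ∉ T'.1 := by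
  classical
  intro hi
  apply hne
  refine Subtype.ext (Finset.eq_of_subset_of_card_le (fun p hp => ?_) ?_)
  · by_cases hpi : p = i
    · rwa [hpi]
    · have : p ∈ (T.side hd i).1 := Finset.mem_erase.2 ⟨hpi, hp⟩
      rw [h] at this
      exact T'.side_isSideOf hd i' this
  · rw [T.2.2, T'.2.2]

theorem Side.centroid_mem_carrier (S : 𝒯.Side) : S.1.centroid ℝ id ∈ S.carrier := by
  have h := apply_centroid S.nonempty (AffineMap.id ℝ (Eucl d))
  rw [AffineMap.id_apply, vertexMean, Finset.smul_sum] at h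
  rw [h]
  refine (convex_convexHull ℝ _).sum_mem (fun _ _ => by positivity) ?_
    fun p hp => subset_convexHull _ _ hp
  have := S.nonempty.card_ne_zero
  simp [this]

theorem Side.carrier_subset {S : 𝒯.Side} {T : 𝒯.Elem} (h : S.IsSideOf T) :
    S.carrier ⊆ T.carrier :=
  convexHull_mono h

theorem Elem.isClosed_carrier (T : 𝒯.Elem) : IsClosed T.carrier := by
  rw [T.carrier_eq]
  exact T.basis.isCompact_convexHull.isClosed

theorem Elem.carrier_subset_closure (T : 𝒯.Elem) : T.carrier ⊆ closure Ω := by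
  rw [← 𝒯.space_eq]
  exact 𝒯.convexHull_subset_space T.2.1

theorem exists_mem_carrier {x : Eucl d} (hx : x ∈ closure Ω) : ∃ T : 𝒯.Elem, x ∈ T.carrier := by
  rw [← 𝒯.space_eq, Geometry.SimplicialComplex.mem_space_iff] at hx
  obtain ⟨s, hs, hxs⟩ := hx
  obtain ⟨t, ht, hst, hc⟩ := 𝒯.exists_elem s hs
  exact ⟨⟨t, ht, hc⟩, convexHull_mono hst hxs⟩

theorem Elem.coord_centroid_side_pos (hd : 1 ≤ d) (T : 𝒯.Elem) {i j : T.1} (h : j ≠ i) :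
    0 < T.basis.coord j ((T.side hd i).1.centroid ℝ id) := by
  have : (0 : ℝ) < d := by exact_mod_cast hd
  rw [T.coord_centroid_side, if_neg h]
  positivity

/-- Two elements sharing a side lie on opposite sides of it. -/
theorem Elem.coord_opposite_neg (hd : 1 ≤ d) {T T' : 𝒯.Elem} (hne : T ≠ T') {i : T.1} {i' : T'.1}
    (h : T.side hd i = T'.side hd i') : T.basis.coord i (i' : Eucl d) < 0 := by
  by_contra! hneg
  set m := (T.side hd i).1.centroid ℝ id with hm
  -- Moving from the barycentre of the side towards i' stays in T'. If the claim failed, a short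
  -- move would stay in T as well; as i' is not a vertex of T, the i'-coordinate, which equals t,
  -- would have to vanish.
  have hev : ∀ j, j ≠ i → ∀ᶠ t : ℝ in 𝓝[>] 0,
      0 < T.basis.coord j (AffineMap.lineMap m (i' : Eucl d) t) := by
    intro j hj
    have hcont : Continuous fun t : ℝ => T.basis.coord j (AffineMap.lineMap m (i' : Eucl d) t) :=
      (continuous_barycentric_coord T.basis j).comp AffineMap.lineMap_continuous
    refine nhdsWithin_le_nhds (hcont.continuousAt.eventually_const_lt ?_)
    simp only [AffineMap.lineMap_apply_zero]
    exact T.coord_centroid_side_pos hd hj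
  have hev' : ∀ᶠ t : ℝ in 𝓝[>] 0, ∀ j, j ≠ i →
      0 < T.basis.coord j (AffineMap.lineMap m (i' : Eucl d) t) :=
    eventually_all.2 fun j => by
      by_cases hj : j = i
      · exact Eventually.of_forall fun _ h => absurd hj h
      · exact (hev j hj).mono fun _ h _ => h
  obtain ⟨t, ⟨ht, ht1⟩, htpos⟩ :=
    (Filter.Eventually.and (Ioo_mem_nhdsGT (zero_lt_one' ℝ)) hev').exists
  set x := AffineMap.lineMap m (i' : Eucl d) t with hx
  have hmi : T.basis.coord i m = 0 := by rw [hm, T.coord_centroid_side, if_pos rfl]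
  have hxT : x ∈ T.carrier := by
    refine Elem.mem_carrier.2 fun j => ?_
    by_cases hj : j = i
    · rw [hj, hx, AffineMap.apply_lineMap, AffineMap.lineMap_apply, hmi]
      simpa using mul_nonneg ht.le hneg
    · exact (htpos j hj).le
  have hmT' : m ∈ T'.carrier := by
    rw [hm, h]
    exact Side.carrier_subset (T'.side_isSideOf hd i') (Side.centroid_mem_carrier _)
  have hxT' : x ∈ T'.carrier :=
    (convex_convexHull ℝ _).lineMap_mem hmT' (subset_convexHull _ _ i'.2) ⟨ht.le, ht1.le⟩
  have h0 := Elem.coord_eq_zero_of_notMem (Elem.vertex_notMem hd hne.symm h.symm) hxT' hxT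
  have hm' : T'.basis.coord i' m = 0 := by rw [hm, h, T'.coord_centroid_side, if_pos rfl]
  have h1 : T'.basis.coord i' (i' : Eucl d) = 1 := T'.basis.coord_apply_eq i'
  rw [hx, AffineMap.apply_lineMap, AffineMap.lineMap_apply, hm', h1] at h0
  simp at h0
  exact ht.ne' h0

/-- Both coordinates are affine and vanish on the common side, hence are proportional; the factor is
read off at i'. -/
theorem Elem.coord_eq_mul (hd : 1 ≤ d) {T T' : 𝒯.Elem} {i : T.1} {i' : T'.1}
    (h : T.side hd i = T'.side hd i') (x : Eucl d) :
    T.basis.coord i x = T'.basis.coord i' x * T.basis.coord i (i' : Eucl d) := by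
  rw [T'.basis.apply_eq_sum_coord_smul (T.basis.coord i) x, Finset.sum_eq_single i']
  · rfl
  · intro j _ hj
    have h1 : (j : Eucl d) ∈ (T.side hd i).1 := by
      rw [h]
      exact (T'.mem_side hd i' j).2 hj
    have h2 := T.basis.coord_apply_ne ((T.mem_side hd i ⟨j, T.side_isSideOf hd i h1⟩).1 h1).symm
    rw [Elem.basis_apply] at h2 ⊢
    rw [h2, smul_zero]
  · exact fun h => absurd (Finset.mem_univ _) h

/-- A side belongs to at most two elements. -/
theorem Side.eq_or_eq_of_isSideOf (hd : 1 ≤ d) {S : 𝒯.Side} {T₁ T₂ T₃ : 𝒯.Elem} (h : T₁ ≠ T₂)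
    (h₁ : S.IsSideOf T₁) (h₂ : S.IsSideOf T₂) (h₃ : S.IsSideOf T₃) : T₃ = T₁ ∨ T₃ = T₂ := by
  by_contra! hne
  obtain ⟨i₁, e₁⟩ := h₁.exists_eq_side hd
  obtain ⟨i₂, e₂⟩ := h₂.exists_eq_side hd
  obtain ⟨i₃, e₃⟩ := h₃.exists_eq_side hd
  have h12 := Elem.coord_opposite_neg hd h (e₁.symm.trans e₂)
  have h13 := Elem.coord_opposite_neg hd hne.1.symm (e₁.symm.trans e₃)
  have h23 := Elem.coord_opposite_neg hd hne.2.symm (e₂.symm.trans e₃)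
  -- Of three elements at one side any two would lie opposite each other, yet a product of two
  -- negative numbers is positive.
  rw [Elem.coord_eq_mul hd (e₁.symm.trans e₂)] at h13
  exact absurd h13 (mul_pos_of_neg_of_neg h23 h12).le.not_gt

/-- A side shared by two elements does not lie on the boundary. -/
theorem Side.not_isBoundary (hd : 1 ≤ d) (hΩ : interior (closure Ω) = Ω) {S : 𝒯.Side}
    {T T' : 𝒯.Elem} (hne : T ≠ T') (h : S.IsSideOf T) (h' : S.IsSideOf T') : ¬ S.IsBoundary := by
  intro hS
  obtain ⟨i, e⟩ := h.exists_eq_side hd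
  obtain ⟨i', e'⟩ := h'.exists_eq_side hd
  have hneg := Elem.coord_opposite_neg hd hne (e.symm.trans e')
  have hfront := hS S.centroid_mem_carrier
  set m := S.1.centroid ℝ id with hm
  have hev : ∀ (T : 𝒯.Elem) (i : T.1), S = T.side hd i →
      ∀ᶠ x in 𝓝 m, ∀ j, j ≠ i → 0 < T.basis.coord j x := by
    intro T i e
    refine eventually_all.2 fun j => ?_
    by_cases hj : j = i
    · exact Eventually.of_forall fun _ h => absurd hj h
    · have hpos : 0 < T.basis.coord j m := by
        rw [hm, e]
        exact T.coord_centroid_side_pos hd hj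
      exact ((continuous_barycentric_coord T.basis j).continuousAt.eventually_const_lt hpos).mono
        fun _ h _ => h
  -- Near the barycentre only the sign of the coordinate opposite the side matters, and T and T'
  -- cover both signs.
  have hnhds : closure Ω ∈ 𝓝 m := by
    filter_upwards [hev T i e, hev T' i' e'] with x hx hx'
    by_cases h0 : 0 ≤ T.basis.coord i x
    · refine T.carrier_subset_closure (Elem.mem_carrier.2 fun j => ?_)
      by_cases hj : j = i
      · rwa [hj]
      · exact (hx j hj).le
    · refine T'.carrier_subset_closure (Elem.mem_carrier.2 fun j => ?_)
      by_cases hj : j = i'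
      · rw [hj]
        rw [Elem.coord_eq_mul hd (e.symm.trans e')] at h0
        by_contra! h1
        exact h0 (mul_pos_of_neg_of_neg h1 hneg).le
      · exact (hx' j hj).le
  have hmΩ : m ∈ Ω := by
    rw [← hΩ]
    exact mem_interior_iff_mem_nhds.2 hnhds
  have hopen : IsOpen Ω := by
    rw [← hΩ]
    exact isOpen_interior
  rw [hopen.frontier_eq] at hfront
  exact hfront.2 hmΩ

/-- A side that belongs to only one element lies on the boundary. -/
theorem Side.isBoundary_of_unique (hd : 1 ≤ d) {S : 𝒯.Side} {T : 𝒯.Elem} (h : S.IsSideOf T)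
    (huniq : ∀ T' : 𝒯.Elem, S.IsSideOf T' → T' = T) : S.IsBoundary := by
  obtain ⟨i, rfl⟩ := h.exists_eq_side hd
  -- First the points in the relative interior of the side. Another element containing such a point
  -- would contain all vertices of the side. So if x were interior to Ω, then T alone would be a
  -- neighbourhood of x, although x has a zero coordinate.
  have key : ∀ x : Eucl d, (∀ j, j ≠ i → 0 < T.basis.coord j x) → T.basis.coord i x = 0 →
      x ∈ frontier Ω := by
    intro x hx hxi
    have hxT : x ∈ T.carrier := Elem.mem_carrier.2 fun j => by
      by_cases hj : j = i
      · rw [hj, hxi]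
      · exact (hx j hj).le
    refine ⟨T.carrier_subset_closure hxT, fun hint => ?_⟩
    have hcl : closure Ω ∈ 𝓝 x :=
      mem_of_superset (mem_interior_iff_mem_nhds.1 hint) subset_closure
    have hother : ∀ᶠ z in 𝓝 x, ∀ T' : 𝒯.Elem, T' ≠ T → z ∉ T'.carrier := by
      refine eventually_all.2 fun T' => ?_
      by_cases hT' : T' = T
      · exact Eventually.of_forall fun _ h => absurd hT' h
      · have hxT' : x ∉ T'.carrier := by
          intro hxT'
          refine hT' (huniq T' fun p hp => ?_)
          by_contra hpT'
          have hpT := T.side_isSideOf hd i hp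
          have h0 := Elem.coord_eq_zero_of_notMem (j := ⟨p, hpT⟩) hpT' hxT hxT'
          exact (hx ⟨p, hpT⟩ ((T.mem_side hd i ⟨p, hpT⟩).1 hp)).ne' h0
        filter_upwards [T'.isClosed_carrier.isOpen_compl.mem_nhds hxT'] with z hz _ using hz
    have hT : T.carrier ∈ 𝓝 x := by
      filter_upwards [hcl, hother] with z hz hz'
      obtain ⟨T', hT'⟩ := exists_mem_carrier (𝒯 := 𝒯) hz
      by_cases hTT : T' = T
      · rwa [← hTT]
      · exact absurd hT' (hz' T' hTT)
    rw [← mem_interior_iff_mem_nhds, T.carrier_eq, T.basis.interior_convexHull] at hT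
    exact (hT i).ne' hxi
  intro x hx
  rw [T.side_carrier] at hx
  set m := (T.side hd i).1.centroid ℝ id with hm
  -- The remaining points are limits of relative interior points, and the frontier is closed.
  have hlim : Tendsto (fun t : ℝ => AffineMap.lineMap x m t) (𝓝[>] 0) (𝓝 x) := by
    have hcont : Continuous fun t : ℝ => AffineMap.lineMap x m t := AffineMap.lineMap_continuous
    have := hcont.tendsto 0
    rw [AffineMap.lineMap_apply_zero] at this
    exact this.mono_left nhdsWithin_le_nhds
  refine isClosed_frontier.mem_of_tendsto hlim ?_
  filter_upwards [Ioo_mem_nhdsGT (zero_lt_one' ℝ)] with t ht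
  have hcoord : ∀ j, T.basis.coord j (AffineMap.lineMap x m t) =
      (1 - t) * T.basis.coord j x + t * T.basis.coord j m := by
    intro j
    rw [AffineMap.apply_lineMap, AffineMap.lineMap_apply]
    simp
    ring
  refine key _ (fun j hj => ?_) ?_
  · rw [hcoord]
    have h1 := T.coord_centroid_side_pos hd hj
    have h2 := mul_nonneg (sub_nonneg.2 ht.2.le) (hx.1 j)
    have h3 := mul_pos ht.1 h1
    linarith
  · rw [hcoord, hx.2, hm, T.coord_centroid_side, if_pos rfl]
    simp

theorem mem_sidesOn {γ : Set (Eucl d)} {S : 𝒯.Side} :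
    S ∈ 𝒯.sidesOn γ ↔ S.IsBoundary ∧ intrinsicInterior ℝ S.carrier ⊆ γ := by
  simp [sidesOn]

/-- The relative interior of a side is nonempty, so it cannot lie in two disjoint boundary parts. -/
theorem disjoint_sidesOn {γ γ' : Set (Eucl d)} (h : Disjoint γ γ') :
    Disjoint (𝒯.sidesOn γ) (𝒯.sidesOn γ') := by
  rw [Finset.disjoint_left]
  intro S hS hS'
  obtain ⟨x, hx⟩ := (Set.Nonempty.intrinsicInterior (convex_convexHull ℝ (S.1 : Set (Eucl d)))
    S.nonempty.to_set.convexHull)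
  exact Set.disjoint_left.1 h ((mem_sidesOn.1 hS).2 hx) ((mem_sidesOn.1 hS').2 hx)

/-! ### Linearity of the discrete operators -/

theorem vertexMean_add_smul {s : Finset (Eucl d)} (t : ℝ) (v w : Eucl d → ℝ) :
    vertexMean s (v + t • w) = vertexMean s v + t * vertexMean s w := by
  simp only [vertexMean, Pi.add_apply, Pi.smul_apply, smul_eq_mul, Finset.sum_add_distrib,
    ← Finset.mul_sum]
  ring

theorem grad_add_smul (v w : 𝒯.L1) (t : ℝ) (T : 𝒯.Elem) :
    grad (v + t • w) T = grad v T + t • grad w T := by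
  rw [grad_eq, grad_eq, grad_eq]
  refine ext_inner_right ℝ fun x => ?_
  rw [inner_add_left, real_inner_smul_left]
  simp only [AffineMap.inner_grad]
  simp

theorem proj_add_smul (v w : 𝒯.L1) (t : ℝ) (T : 𝒯.Elem) :
    proj (v + t • w) T = proj v T + t * proj w T := by
  simp only [proj_eq]
  exact vertexMean_add_smul t _ _

theorem sideProj_add_smul (hd : 1 ≤ d) (v w : 𝒯.L1) (t : ℝ) (S : 𝒯.Side) :
    sideProj (v + t • w) S = sideProj v S + t * sideProj w S := by
  simp only [sideProj_eq hd]
  exact vertexMean_add_smul t _ _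

/-! ### Crouzeix–Raviart functions -/

theorem isCR_iff (hd : 1 ≤ d) {v : 𝒯.L1} :
    IsCR v ↔ ∀ (S : 𝒯.Side) (T T' : 𝒯.Elem), S.IsSideOf T → S.IsSideOf T' →
      vertexMean S.1 (v T) = vertexMean S.1 (v T') := by
  have h : ∀ (S : 𝒯.Side) (T T' : 𝒯.Elem), ⨍ x in S.carrier, (v T x - v T' x) ∂(surf d) =
      vertexMean S.1 (v T) - vertexMean S.1 (v T') := by
    intro S T T'
    refine (S.setAverage_eq hd (v T - v T')).trans ?_
    simp [vertexMean, mul_sub]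
  constructor
  · intro hv S T T' hT hT'
    by_cases hne : T = T'
    · rw [hne]
    · have := hv S T T' hne hT hT'
      rwa [h, sub_eq_zero] at this
  · intro hv S T T' _ hT hT'
    rw [h, sub_eq_zero]
    exact hv S T T' hT hT'

theorem Side.isSideOf_elem (S : 𝒯.Side) : S.IsSideOf S.elem := S.exists_isSideOf.choose_spec

theorem IsCR.vertexMean_eq (hd : 1 ≤ d) {v : 𝒯.L1} (hv : IsCR v) {S : 𝒯.Side} {T : 𝒯.Elem}
    (h : S.IsSideOf T) : vertexMean S.1 (v T) = sideProj v S := by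
  rw [sideProj_eq hd]
  exact (isCR_iff hd).1 hv S T _ h S.isSideOf_elem

theorem IsCR.add_smul (hd : 1 ≤ d) {v w : 𝒯.L1} (hv : IsCR v) (hw : IsCR w) (t : ℝ) :
    IsCR (v + t • w) := by
  rw [isCR_iff hd] at hv hw ⊢
  intro S T T' hT hT'
  refine (vertexMean_add_smul t (v T) (w T)).trans ?_
  rw [hv S T T' hT hT', hw S T T' hT hT']
  exact (vertexMean_add_smul t (v T') (w T')).symm

open Classical in
/-- The Crouzeix–Raviart basis function of a side. -/
def hat (hd : 1 ≤ d) (S : 𝒯.Side) : 𝒯.L1 := fun T =>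
  if h : S.IsSideOf T then
    AffineMap.const ℝ (Eucl d) 1 - (d : ℝ) • T.basis.coord (h.exists_eq_side hd).choose
  else 0

-- The value at a barycentre is 1 - d · coord: the coordinate is 0 on the side itself and 1/d at the
-- barycentres of the other sides of the element.
open Classical in
theorem vertexMean_hat (hd : 1 ≤ d) (S₀ : 𝒯.Side) {S : 𝒯.Side} {T : 𝒯.Elem} (h : S.IsSideOf T) :
    vertexMean S.1 (hat hd S₀ T) = if S = S₀ then 1 else 0 := by
  rw [← apply_centroid S.nonempty]
  by_cases h₀ : S₀.IsSideOf T
  · obtain ⟨i, rfl⟩ := h.exists_eq_side hd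
    have hi₀ := (h₀.exists_eq_side hd).choose_spec
    have hd0 : (d : ℝ) ≠ 0 := by
      have : d ≠ 0 := by omega
      exact_mod_cast this
    rw [hat, dif_pos h₀]
    set i₀ := (h₀.exists_eq_side hd).choose
    have : T.side hd i = S₀ ↔ i₀ = i := by
      rw [hi₀, (T.side_injective hd).eq_iff, eq_comm]
    simp only [this, AffineMap.coe_sub, AffineMap.coe_smul, Pi.sub_apply, Pi.smul_apply,
      AffineMap.const_apply, T.coord_centroid_side, smul_eq_mul]
    by_cases h1 : i₀ = i <;> simp [h1, hd0]
  · have hne : S ≠ S₀ := by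
      rintro rfl
      exact h₀ h
    rw [hat, dif_neg h₀, if_neg hne]
    rfl

theorem isCR_hat (hd : 1 ≤ d) (S₀ : 𝒯.Side) : IsCR (hat hd S₀) := by
  rw [isCR_iff hd]
  intro S T T' h h'
  rw [vertexMean_hat hd S₀ h, vertexMean_hat hd S₀ h']

open Classical in
theorem sideProj_hat (hd : 1 ≤ d) (S₀ S : 𝒯.Side) :
    sideProj (hat hd S₀) S = if S = S₀ then 1 else 0 := by
  rw [sideProj_eq hd, vertexMean_hat hd S₀ S.isSideOf_elem]

/-! ### Normal components -/

/-- The normal component of the field `y` on the element `T`, at the barycentre of the side `S`. -/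
def normalComp (y : 𝒯.L1Vec) (T : 𝒯.Elem) (S : 𝒯.Side) : ℝ :=
  inner ℝ (y T (S.1.centroid ℝ id)) (normal T S)

/-- On each element, the normal component of `y` is constant on each side. -/
def HasConstNormal (y : 𝒯.L1Vec) : Prop :=
  ∀ (T : 𝒯.Elem) (S : 𝒯.Side), S.IsSideOf T →
    ∀ x ∈ S.carrier, inner ℝ (y T x) (normal T S) = normalComp y T S

theorem IsRT.hasConstNormal {y : 𝒯.L1Vec} (hy : IsRT y) : HasConstNormal y := by
  intro T S h x hx
  obtain ⟨c, hc⟩ := hy.1 T S h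
  rw [hc x hx, normalComp, hc _ S.centroid_mem_carrier]

open Classical in
/-- The total outward flux density of `y` from the elements adjacent to `S`. -/
def flow (y : 𝒯.L1Vec) (S : 𝒯.Side) : ℝ := ∑ T : 𝒯.Elem with S.IsSideOf T, normalComp y T S

theorem flow_of_ne (hd : 1 ≤ d) (y : 𝒯.L1Vec) {S : 𝒯.Side} {T T' : 𝒯.Elem} (hne : T ≠ T')
    (h : S.IsSideOf T) (h' : S.IsSideOf T') :
    flow y S = normalComp y T S + normalComp y T' S := by
  classical
  rw [flow, ← Finset.sum_pair (f := fun T => normalComp y T S) hne]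
  refine Finset.sum_congr ?_ fun _ _ => rfl
  ext T₃
  simp only [Finset.mem_filter, Finset.mem_univ, true_and, Finset.mem_insert,
    Finset.mem_singleton]
  constructor
  · exact fun h₃ => Side.eq_or_eq_of_isSideOf hd hne h h' h₃
  · rintro (rfl | rfl) <;> assumption

theorem flow_of_unique (y : 𝒯.L1Vec) {S : 𝒯.Side} {T : 𝒯.Elem} (h : S.IsSideOf T)
    (huniq : ∀ T' : 𝒯.Elem, S.IsSideOf T' → T' = T) : flow y S = normalComp y T S := by
  classical
  rw [flow, Finset.sum_eq_single_of_mem T (by simpa using h)]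
  intro T' hT' hne
  exact absurd (huniq T' (by simpa using hT')) hne

theorem Side.IsBoundary.eq_elem (hd : 1 ≤ d) (hΩ : interior (closure Ω) = Ω) {S : 𝒯.Side}
    (hS : S.IsBoundary) {T : 𝒯.Elem} (h : S.IsSideOf T) : T = S.elem := by
  by_contra hne
  exact Side.not_isBoundary hd hΩ hne h S.isSideOf_elem hS

theorem normalTrace_eq_flow (hd : 1 ≤ d) (hΩ : interior (closure Ω) = Ω) {y : 𝒯.L1Vec}
    (hy : HasConstNormal y) {S : 𝒯.Side} (hS : S.IsBoundary) {x : Eucl d} (hx : x ∈ S.carrier) :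
    normalTrace y S x = flow y S := by
  rw [flow_of_unique y S.isSideOf_elem fun T' h' => hS.eq_elem hd hΩ h']
  exact hy _ S S.isSideOf_elem x hx

theorem setIntegral_normalTrace_mul (hd : 1 ≤ d) (hΩ : interior (closure Ω) = Ω) {y : 𝒯.L1Vec}
    (hy : HasConstNormal y) {S : 𝒯.Side} (hS : S.IsBoundary) (c : ℝ) :
    ∫ x in S.carrier, normalTrace y S x * c ∂(surf d) = S.area * (flow y S * c) := by
  have hmeas : MeasurableSet S.carrier :=
    (S.1.finite_toSet.isCompact_convexHull ℝ).measurableSet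
  rw [setIntegral_congr_fun hmeas (g := fun _ => flow y S * c) fun x hx => by
    simp only [normalTrace_eq_flow hd hΩ hy hS hx]]
  rw [setIntegral_const, smul_eq_mul]
  rfl

/-- A side off the boundary has a second element, and then the flow is the normal jump. -/
theorem IsRT.flow_eq_zero (hd : 1 ≤ d) {y : 𝒯.L1Vec} (hy : IsRT y) {S : 𝒯.Side}
    (hS : ¬ S.IsBoundary) : flow y S = 0 := by
  have : ∃ T' : 𝒯.Elem, S.IsSideOf T' ∧ T' ≠ S.elem := by
    by_contra! h
    exact hS (Side.isBoundary_of_unique hd S.isSideOf_elem h)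
  obtain ⟨T', h', hne⟩ := this
  rw [flow_of_ne hd y hne h' S.isSideOf_elem]
  exact hy.2 S _ _ hne h' S.isSideOf_elem _ S.centroid_mem_carrier

theorem isRT_of_flow (hd : 1 ≤ d) {y : 𝒯.L1Vec} (hy : HasConstNormal y)
    (h : ∀ (S : 𝒯.Side) (T T' : 𝒯.Elem), T ≠ T' → S.IsSideOf T → S.IsSideOf T' → flow y S = 0) :
    IsRT y := by
  refine ⟨fun T S hS => ⟨_, hy T S hS⟩, fun S T T' hne hT hT' x hx => ?_⟩
  rw [hy T S hT x hx, hy T' S hT' x hx, ← flow_of_ne hd y hne hT hT', h S T T' hne hT hT']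

/-- The discrete integration-by-parts formula. -/
theorem HasConstNormal.integration_by_parts (hd : 1 ≤ d) {y : 𝒯.L1Vec} (hy : HasConstNormal y)
    {v : 𝒯.L1} (hv : IsCR v) :
    ∑ T : 𝒯.Elem, T.vol * inner ℝ (grad v T) (projVec y T) + innerL0 (div y) (proj v) =
      ∑ S : 𝒯.Side, S.area * (flow y S * sideProj v S) := by
  classical
  rw [innerL0, ← Finset.sum_add_distrib]
  calc _ = ∑ T : 𝒯.Elem, ∑ S ∈ T.sides, S.area * (normalComp y T S * sideProj v S) := by
        refine Finset.sum_congr rfl fun T _ => ?_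
        rw [T.integration_by_parts hd y v (normalComp y T) (hy T)]
        refine Finset.sum_congr rfl fun S hS => ?_
        rw [hv.vertexMean_eq hd (Elem.mem_sides.1 hS)]
    _ = ∑ S : 𝒯.Side, ∑ T : 𝒯.Elem with S.IsSideOf T,
          S.area * (normalComp y T S * sideProj v S) := by
        refine Finset.sum_comm' fun T S => ?_
        simp [Elem.mem_sides]
    _ = _ := by
        refine Finset.sum_congr rfl fun S _ => ?_
        rw [flow, Finset.sum_mul, Finset.mul_sum]

/-! ### The discrete flux -/

theorem flux_apply (f : 𝒯.L0) (u : 𝒯.L1) (T : 𝒯.Elem) (x : Eucl d) :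
    flux f u T x = grad u T - (f T / d) • (x - T.1.centroid ℝ id) := by
  have h : projVec (idField (𝒯 := 𝒯)) T = T.1.centroid ℝ id := by
    rw [projVec_eq, ← apply_centroid T.nonempty]
    rfl
  rw [← h]
  rfl

theorem projVec_flux (f : 𝒯.L0) (u : 𝒯.L1) (T : 𝒯.Elem) : projVec (flux f u) T = grad u T := by
  rw [projVec_eq, ← apply_centroid T.nonempty, flux_apply]
  simp

theorem div_flux (hd : 1 ≤ d) (f : 𝒯.L0) (u : 𝒯.L1) (T : 𝒯.Elem) :
    div (flux f u) T = -f T := by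
  have hd0 : (d : ℝ) ≠ 0 := by
    have : d ≠ 0 := by omega
    exact_mod_cast this
  have h : (flux f u T).linear = -(f T / d) • LinearMap.id := by
    ext1 x
    have h1 : (flux f u T).linear x = flux f u T (x +ᵥ (0 : Eucl d)) - flux f u T 0 := by
      rw [AffineMap.map_vadd, vadd_eq_add, add_sub_cancel_right]
    rw [h1, flux_apply, flux_apply]
    simp only [vadd_eq_add, add_zero, LinearMap.smul_apply, LinearMap.id_apply]
    module
  rw [div, h, map_smul, LinearMap.trace_id]
  simp [hd0]

/-- Between two points of a side the flux changes by a multiple of their difference, which is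
tangential. -/
theorem hasConstNormal_flux (hd : 1 ≤ d) (f : 𝒯.L0) (u : 𝒯.L1) : HasConstNormal (flux f u) := by
  intro T S h x hx
  have hc := S.centroid_mem_carrier
  obtain ⟨i, rfl⟩ := h.exists_eq_side hd
  rw [normalComp, ← sub_eq_zero, ← inner_sub_left, flux_apply, flux_apply]
  set m := (T.side hd i).1.centroid ℝ id
  rw [T.side_carrier] at hx hc
  have h0 : inner ℝ (T.basis.coord i).grad (x - m) = 0 := by
    rw [AffineMap.inner_grad, ← vsub_eq_sub, AffineMap.linearMap_vsub, hx.2, hc.2, vsub_self]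
  have h1 : grad u T - (f T / d) • (x - T.1.centroid ℝ id) -
      (grad u T - (f T / d) • (m - T.1.centroid ℝ id)) = -(f T / d) • (x - m) := by
    module
  rw [h1, T.normal_side, inner_neg_right, inner_smul_right, real_inner_smul_left, real_inner_comm,
    h0]
  simp

/-! ### Stationarity -/

/-- The real-valued part of the discrete primal energy. -/
def primalReal (ΓN : Set (Eucl d)) (f : 𝒯.L0) (g : 𝒯.SideL0) (v : 𝒯.L1) : ℝ :=
  1 / 2 * normSq (grad v) - innerL0 f (proj v) - ∑ S ∈ 𝒯.sidesOn ΓN, S.area * (g S * sideProj v S)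

theorem normSq_grad_add_smul (u φ : 𝒯.L1) (t : ℝ) :
    normSq (grad (u + t • φ)) = normSq (grad u) +
      2 * t * ∑ T : 𝒯.Elem, T.vol * inner ℝ (grad φ T) (grad u T) + t ^ 2 * normSq (grad φ) := by
  simp only [normSq, Finset.mul_sum, ← Finset.sum_add_distrib]
  refine Finset.sum_congr rfl fun T _ => ?_
  rw [grad_add_smul, norm_add_sq_real, inner_smul_right, norm_smul, real_inner_comm, mul_pow,
    Real.norm_eq_abs, sq_abs]
  ring

/-- Because Π z = ∇u and div z = -f for the flux z, integration by parts writes the linear term in t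
through side means of φ only. -/
theorem primalReal_add_smul (hd : 1 ≤ d) (ΓN : Set (Eucl d)) (f : 𝒯.L0) (g : 𝒯.SideL0)
    (u : 𝒯.L1) {φ : 𝒯.L1} (hφ : IsCR φ) (t : ℝ) :
    primalReal ΓN f g (u + t • φ) = primalReal ΓN f g u +
      t * (∑ S : 𝒯.Side, S.area * (flow (flux f u) S * sideProj φ S) -
        ∑ S ∈ 𝒯.sidesOn ΓN, S.area * (g S * sideProj φ S)) +
      t ^ 2 * (1 / 2 * normSq (grad φ)) := by
  have h1 : innerL0 f (proj (u + t • φ)) = innerL0 f (proj u) + t * innerL0 f (proj φ) := by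
    simp only [innerL0, Finset.mul_sum, ← Finset.sum_add_distrib]
    refine Finset.sum_congr rfl fun T _ => ?_
    rw [proj_add_smul]
    ring
  have h2 : ∑ S ∈ 𝒯.sidesOn ΓN, S.area * (g S * sideProj (u + t • φ) S) =
      ∑ S ∈ 𝒯.sidesOn ΓN, S.area * (g S * sideProj u S) +
        t * ∑ S ∈ 𝒯.sidesOn ΓN, S.area * (g S * sideProj φ S) := by
    simp only [Finset.mul_sum, ← Finset.sum_add_distrib]
    refine Finset.sum_congr rfl fun S _ => ?_
    rw [sideProj_add_smul hd]
    ring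
  have h3 := (hasConstNormal_flux hd f u).integration_by_parts hd hφ
  have h4 : innerL0 (div (flux f u)) (proj φ) = -innerL0 f (proj φ) := by
    simp only [innerL0, div_flux hd, ← Finset.sum_neg_distrib]
    refine Finset.sum_congr rfl fun T _ => ?_
    ring
  simp only [projVec_flux, h4] at h3
  rw [primalReal, primalReal, normSq_grad_add_smul, h1, h2, ← h3]
  ring

theorem IsPrimalSolution.primalReal_le {ΓD ΓN ΓC : Set (Eucl d)} {f : 𝒯.L0} {g uD χ : 𝒯.SideL0}
    {u v : 𝒯.L1} (hu : IsPrimalSolution ΓD ΓN ΓC f g uD χ u) (hv : v ∈ primalSet ΓD ΓC uD χ) :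
    primalReal ΓN f g u ≤ primalReal ΓN f g v := by
  have h := hu.2 hv.1
  simp only [Set.mem_ofPred_eq, primalEnergy, if_pos hu.1, if_pos hv, add_zero] at h
  exact EReal.coe_le_coe_iff.1 h

theorem nonneg_of_forall_small {L Q δ : ℝ} (hδ : 0 < δ) (hQ : 0 ≤ Q)
    (h : ∀ t, 0 ≤ t → t ≤ δ → 0 ≤ t * L + t ^ 2 * Q) : 0 ≤ L := by
  by_contra! hL
  have hQ1 : 0 < Q + 1 := by linarith
  have hpos : 0 < -L / (Q + 1) := div_pos (by linarith) hQ1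
  -- With this t one has t(Q + 1) ≤ -L, so tL + t²Q ≤ -t² < 0. Using Q + 1 avoids dividing by zero.
  set t := min δ (-L / (Q + 1)) with ht
  have ht0 : 0 < t := lt_min hδ hpos
  have h1 := h t ht0.le (min_le_left _ _)
  have h2 : t * (Q + 1) ≤ -L := (le_div_iff₀ hQ1).1 (min_le_right _ _)
  nlinarith

-- Adding t times the basis function of S₀ changes only the mean on S₀, so the Dirichlet condition
-- and the constraints on the other contact sides persist.
open Classical in
theorem IsPrimalSolution.variation_nonneg (hd : 1 ≤ d) {ΓD ΓN ΓC : Set (Eucl d)} {f : 𝒯.L0}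
    {g uD χ : 𝒯.SideL0} {u : 𝒯.L1} (hu : IsPrimalSolution ΓD ΓN ΓC f g uD χ u) {S₀ : 𝒯.Side}
    (hD : S₀ ∉ 𝒯.sidesOn ΓD) {t : ℝ} (ht : S₀ ∈ 𝒯.sidesOn ΓC → χ S₀ ≤ sideProj u S₀ + t) :
    0 ≤ t * (S₀.area * (flow (flux f u) S₀ - if S₀ ∈ 𝒯.sidesOn ΓN then g S₀ else 0)) +
      t ^ 2 * (1 / 2 * normSq (grad (hat hd S₀))) := by
  have hmem : u + t • hat hd S₀ ∈ primalSet ΓD ΓC uD χ := by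
    refine ⟨hu.1.1.add_smul hd (isCR_hat hd S₀) t, fun S hS => ?_, fun S hS => ?_⟩
    · have hne : S ≠ S₀ := by
        rintro rfl
        exact hD hS
      rw [sideProj_add_smul hd, sideProj_hat, if_neg hne, mul_zero, add_zero, hu.1.2.1 S hS]
    · rw [sideProj_add_smul hd, sideProj_hat]
      by_cases hne : S = S₀
      · subst hne
        rw [if_pos rfl, mul_one]
        exact ht hS
      · rw [if_neg hne, mul_zero, add_zero]
        exact hu.1.2.2 S hS
  have h := hu.primalReal_le hmem
  rw [primalReal_add_smul hd ΓN f g u (isCR_hat hd S₀) t] at h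
  have e1 : ∑ S : 𝒯.Side, S.area * (flow (flux f u) S * sideProj (hat hd S₀) S) =
      S₀.area * flow (flux f u) S₀ := by
    simp [sideProj_hat]
  have e2 : ∑ S ∈ 𝒯.sidesOn ΓN, S.area * (g S * sideProj (hat hd S₀) S) =
      S₀.area * if S₀ ∈ 𝒯.sidesOn ΓN then g S₀ else 0 := by
    simp [sideProj_hat]
  rw [e1, e2, ← mul_sub] at h
  linarith

theorem normSq_nonneg (p : 𝒯.L0Vec) : 0 ≤ normSq p :=
  Finset.sum_nonneg fun T _ => mul_nonneg T.vol_pos.le (by positivity)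

-- Without a constraint on the side both signs of t are allowed, so the first variation vanishes.
open Classical in
theorem IsPrimalSolution.flow_flux_eq (hd : 1 ≤ d) {ΓD ΓN ΓC : Set (Eucl d)} {f : 𝒯.L0}
    {g uD χ : 𝒯.SideL0} {u : 𝒯.L1} (hu : IsPrimalSolution ΓD ΓN ΓC f g uD χ u) {S₀ : 𝒯.Side}
    (hD : S₀ ∉ 𝒯.sidesOn ΓD) (hC : S₀ ∉ 𝒯.sidesOn ΓC) :
    flow (flux f u) S₀ = if S₀ ∈ 𝒯.sidesOn ΓN then g S₀ else 0 := by
  have h := fun t => hu.variation_nonneg hd hD (t := t) fun h => absurd h hC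
  have hQ : 0 ≤ 1 / 2 * normSq (grad (hat hd S₀)) := mul_nonneg (by norm_num) (normSq_nonneg _)
  have h1 := nonneg_of_forall_small one_pos hQ fun t _ _ => h t
  have h2 := nonneg_of_forall_small (L := -(S₀.area * _)) one_pos hQ fun t _ _ => by
    have := h (-t)
    rwa [neg_sq, neg_mul, ← mul_neg] at this
  have h3 := le_antisymm (neg_nonneg.1 h2) h1
  exact sub_eq_zero.1 ((mul_eq_zero.1 h3).resolve_left (S₀.area_pos hd).ne')

/-- Increasing the mean is always admissible, which gives the sign. If the mean exceeds the
obstacle, decreasing it by at most the gap is admissible too, which forces the flow to vanish. -/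
theorem IsPrimalSolution.flow_flux_contact (hd : 1 ≤ d) {ΓD ΓN ΓC : Set (Eucl d)} {f : 𝒯.L0}
    {g uD χ : 𝒯.SideL0} {u : 𝒯.L1} (hu : IsPrimalSolution ΓD ΓN ΓC f g uD χ u) {S₀ : 𝒯.Side}
    (hD : S₀ ∉ 𝒯.sidesOn ΓD) (hN : S₀ ∉ 𝒯.sidesOn ΓN) (hC : S₀ ∈ 𝒯.sidesOn ΓC) :
    0 ≤ flow (flux f u) S₀ ∧ flow (flux f u) S₀ * (sideProj u S₀ - χ S₀) = 0 := by
  have hχ := hu.1.2.2 S₀ hC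
  have h := fun (t : ℝ) (ht : χ S₀ ≤ sideProj u S₀ + t) =>
    hu.variation_nonneg hd hD (t := t) fun _ => ht
  simp only [if_neg hN, sub_zero] at h
  have hQ : 0 ≤ 1 / 2 * normSq (grad (hat hd S₀)) := mul_nonneg (by norm_num) (normSq_nonneg _)
  have h1 := nonneg_of_forall_small one_pos hQ fun t ht _ => h t (by linarith)
  have h1' : 0 ≤ flow (flux f u) S₀ := nonneg_of_mul_nonneg_right h1 (S₀.area_pos hd)
  refine ⟨h1', ?_⟩
  rcases hχ.eq_or_lt with heq | hlt
  · rw [heq, sub_self, mul_zero]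
  · have h2 := nonneg_of_forall_small (L := -(S₀.area * _)) (sub_pos.2 hlt) hQ fun t _ ht => by
      have := h (-t) (by linarith)
      rwa [neg_sq, neg_mul, ← mul_neg] at this
    have h3 := le_antisymm (neg_nonneg.1 h2) h1
    rw [(mul_eq_zero.1 h3).resolve_left (S₀.area_pos hd).ne', zero_mul]

/-! ### Duality -/

theorem sum_eq_sum_sidesOn {ΓD ΓN ΓC : Set (Eucl d)} (hΓ : IsBoundaryDecomposition Ω ΓD ΓN ΓC)
    (h𝒯 : 𝒯.Resolves ΓD ΓN ΓC) {F : 𝒯.Side → ℝ} (hF : ∀ S : 𝒯.Side, ¬ S.IsBoundary → F S = 0) :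
    ∑ S : 𝒯.Side, F S =
      ∑ S ∈ 𝒯.sidesOn ΓD, F S + ∑ S ∈ 𝒯.sidesOn ΓN, F S + ∑ S ∈ 𝒯.sidesOn ΓC, F S := by
  classical
  have hDN := disjoint_sidesOn (𝒯 := 𝒯) hΓ.disjointDN
  have hDC := disjoint_sidesOn (𝒯 := 𝒯) hΓ.disjointDC
  have hNC := disjoint_sidesOn (𝒯 := 𝒯) hΓ.disjointNC
  rw [← Finset.sum_union hDN, ← Finset.sum_union (Finset.disjoint_union_left.2 ⟨hDC, hNC⟩)]
  refine (Finset.sum_subset (Finset.subset_univ _) fun S _ hS => hF S fun hb => hS ?_).symm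
  rcases h𝒯 S hb with h | h | h <;> simp [h]

/-- The tangent inequality of the convex function `normSq` at p, from ‖q - p‖² ≥ 0. -/
theorem normSq_ge (p q : 𝒯.L0Vec) :
    normSq p + 2 * (∑ T : 𝒯.Elem, T.vol * inner ℝ (p T) (q T) -
      ∑ T : 𝒯.Elem, T.vol * inner ℝ (p T) (p T)) ≤ normSq q := by
  simp only [normSq, ← Finset.sum_sub_distrib, Finset.mul_sum, ← Finset.sum_add_distrib]
  refine Finset.sum_le_sum fun T _ => ?_
  have h1 : 0 ≤ T.vol * ‖q T - p T‖ ^ 2 := mul_nonneg T.vol_pos.le (by positivity)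
  rw [norm_sub_sq_real, real_inner_comm] at h1
  rw [real_inner_self_eq_norm_sq]
  linarith

theorem dualReal_le (hd : 1 ≤ d) (hΩ : interior (closure Ω) = Ω)
    {ΓD ΓN ΓC : Set (Eucl d)} (hΓ : IsBoundaryDecomposition Ω ΓD ΓN ΓC) (h𝒯 : 𝒯.Resolves ΓD ΓN ΓC)
    {f : 𝒯.L0} {g uD χ : 𝒯.SideL0} (hχ : ∀ S ∈ 𝒯.sidesOn ΓD, χ S = uD S)
    {u : 𝒯.L1} (hu : u ∈ primalSet ΓD ΓC uD χ) {y z : 𝒯.L1Vec} (hy : y ∈ dualSet ΓN ΓC f g)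
    (hz : z ∈ dualSet ΓN ΓC f g) (hzu : ∀ T, projVec z T = grad u T)
    (hzc : ∀ S ∈ 𝒯.sidesOn ΓC, flow z S * (sideProj u S - χ S) = 0) :
    -(1 / 2) * normSq (projVec y) + (∑ S ∈ 𝒯.sidesOn ΓD, S.area * (flow y S * χ S) +
        ∑ S ∈ 𝒯.sidesOn ΓC, S.area * (flow y S * χ S)) ≤
      -(1 / 2) * normSq (projVec z) + (∑ S ∈ 𝒯.sidesOn ΓD, S.area * (flow z S * χ S) +
        ∑ S ∈ 𝒯.sidesOn ΓC, S.area * (flow z S * χ S)) := by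
  -- Used for w = y and w = z: the load and Neumann terms are the same for both and cancel in the
  -- difference.
  have ibp : ∀ w ∈ dualSet ΓN ΓC f g,
      ∑ T : 𝒯.Elem, T.vol * inner ℝ (projVec z T) (projVec w T) - innerL0 f (proj u) =
        ∑ S ∈ 𝒯.sidesOn ΓD, S.area * (flow w S * χ S) +
        ∑ S ∈ 𝒯.sidesOn ΓN, S.area * (g S * sideProj u S) +
        ∑ S ∈ 𝒯.sidesOn ΓC, S.area * (flow w S * sideProj u S) := by
    intro w hw
    have h := hw.1.hasConstNormal.integration_by_parts hd hu.1
    have h4 : innerL0 (div w) (proj u) = -innerL0 f (proj u) := by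
      simp only [innerL0, hw.2.1, ← Finset.sum_neg_distrib]
      refine Finset.sum_congr rfl fun T _ => ?_
      ring
    rw [h4, sum_eq_sum_sidesOn hΓ h𝒯 fun S hS => by rw [hw.1.flow_eq_zero hd hS]; ring] at h
    simp only [hzu, sub_eq_add_neg]
    rw [h]
    congr 2
    · refine Finset.sum_congr rfl fun S hS => ?_
      rw [hu.2.1 S hS, hχ S hS]
    · refine Finset.sum_congr rfl fun S hS => ?_
      rw [← normalTrace_eq_flow hd hΩ hw.1.hasConstNormal (mem_sidesOn.1 hS).1
        S.centroid_mem_carrier, hw.2.2.1 S hS _ S.centroid_mem_carrier]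
  have hcy : ∑ S ∈ 𝒯.sidesOn ΓC, S.area * (flow y S * χ S) ≤
      ∑ S ∈ 𝒯.sidesOn ΓC, S.area * (flow y S * sideProj u S) := by
    refine Finset.sum_le_sum fun S hS => ?_
    have h1 := hy.2.2.2 S hS _ S.centroid_mem_carrier
    rw [normalTrace_eq_flow hd hΩ hy.1.hasConstNormal (mem_sidesOn.1 hS).1
      S.centroid_mem_carrier] at h1
    exact mul_le_mul_of_nonneg_left (mul_le_mul_of_nonneg_left (hu.2.2 S hS) h1)
      (S.area_pos hd).le
  have hcz : ∑ S ∈ 𝒯.sidesOn ΓC, S.area * (flow z S * χ S) =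
      ∑ S ∈ 𝒯.sidesOn ΓC, S.area * (flow z S * sideProj u S) := by
    refine Finset.sum_congr rfl fun S hS => ?_
    have := hzc S hS
    rw [mul_sub, sub_eq_zero] at this
    rw [this]
  have h1 := ibp y hy
  have h2 := ibp z hz
  have h3 := normSq_ge (projVec z) (projVec y)
  linarith

end

end Mesh

/-! ### Optimality of the flux. -/

theorem proposition5p2 {d : ℕ} (hd : 1 ≤ d)
    {Ω : Set (Eucl d)} (hΩ : interior (closure Ω) = Ω)
    {ΓD ΓN ΓC : Set (Eucl d)} (hΓ : IsBoundaryDecomposition Ω ΓD ΓN ΓC)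
    (𝒯 : Mesh d Ω) (h𝒯 : 𝒯.Resolves ΓD ΓN ΓC)
    (f : 𝒯.L0) (g uD χ : 𝒯.SideL0) (hχ : ∀ S ∈ 𝒯.sidesOn ΓD, χ S = uD S)
    (u : 𝒯.L1) (hu : Mesh.IsPrimalSolution ΓD ΓN ΓC f g uD χ u) :
    Mesh.IsRT (Mesh.flux f u) ∧
    (∀ T : 𝒯.Elem, Mesh.div (Mesh.flux f u) T = -f T) ∧
    (∀ S ∈ 𝒯.sidesOn ΓN, ∀ x ∈ S.carrier, Mesh.normalTrace (Mesh.flux f u) S x = g S) ∧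
    (∀ S ∈ 𝒯.sidesOn ΓC, ∀ x ∈ S.carrier, 0 ≤ Mesh.normalTrace (Mesh.flux f u) S x) ∧
    (∀ T : 𝒯.Elem, Mesh.projVec (Mesh.flux f u) T = Mesh.grad u T) ∧
    (∀ S ∈ 𝒯.sidesOn ΓC, ∀ x ∈ S.carrier,
      Mesh.normalTrace (Mesh.flux f u) S x * (Mesh.sideProj u S - χ S) = 0) ∧
    Mesh.IsDualSolution ΓD ΓN ΓC f g χ (Mesh.flux f u) := by
  classical
  have hDN := Mesh.disjoint_sidesOn (𝒯 := 𝒯) hΓ.disjointDN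
  have hDC := Mesh.disjoint_sidesOn (𝒯 := 𝒯) hΓ.disjointDC
  have hNC := Mesh.disjoint_sidesOn (𝒯 := 𝒯) hΓ.disjointNC
  have hconst := Mesh.hasConstNormal_flux hd f u
  have htrace : ∀ γ : Set (Eucl d), ∀ S ∈ 𝒯.sidesOn γ, ∀ x ∈ S.carrier,
      Mesh.normalTrace (Mesh.flux f u) S x = Mesh.flow (Mesh.flux f u) S := fun γ S hS x hx =>
    Mesh.normalTrace_eq_flow hd hΩ hconst (Mesh.mem_sidesOn.1 hS).1 hx
  have hRT : Mesh.IsRT (Mesh.flux f u) := by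
    refine Mesh.isRT_of_flow hd hconst fun S T T' hne h h' => ?_
    have hint : ∀ γ : Set (Eucl d), S ∉ 𝒯.sidesOn γ := fun γ hS =>
      Mesh.Side.not_isBoundary hd hΩ hne h h' (Mesh.mem_sidesOn.1 hS).1
    rw [hu.flow_flux_eq hd (hint _) (hint _), if_neg (hint _)]
  have hN : ∀ S ∈ 𝒯.sidesOn ΓN, ∀ x ∈ S.carrier, Mesh.normalTrace (Mesh.flux f u) S x = g S := by
    intro S hS x hx
    rw [htrace _ S hS x hx, hu.flow_flux_eq hd (Finset.disjoint_right.1 hDN hS)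
      (Finset.disjoint_left.1 hNC hS), if_pos hS]
  have hC : ∀ S ∈ 𝒯.sidesOn ΓC, 0 ≤ Mesh.flow (Mesh.flux f u) S ∧
      Mesh.flow (Mesh.flux f u) S * (Mesh.sideProj u S - χ S) = 0 := fun S hS =>
    hu.flow_flux_contact hd (Finset.disjoint_right.1 hDC hS) (Finset.disjoint_right.1 hNC hS) hS
  have hC0 : ∀ S ∈ 𝒯.sidesOn ΓC, ∀ x ∈ S.carrier,
      0 ≤ Mesh.normalTrace (Mesh.flux f u) S x := fun S hS x hx => by
    rw [htrace _ S hS x hx]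
    exact (hC S hS).1
  have hz : Mesh.flux f u ∈ Mesh.dualSet ΓN ΓC f g := ⟨hRT, Mesh.div_flux hd f u, hN, hC0⟩
  refine ⟨hRT, Mesh.div_flux hd f u, hN, hC0, Mesh.projVec_flux f u, fun S hS x hx => ?_,
    hRT, fun y hy => ?_⟩
  · rw [htrace _ S hS x hx]
    exact (hC S hS).2
  · have hy' : Mesh.IsRT y := hy
    simp only [Set.mem_ofPred_eq, Mesh.dualEnergy, if_pos hz, sub_zero]
    by_cases hyd : y ∈ Mesh.dualSet ΓN ΓC f g
    · have hint : ∀ w : 𝒯.L1Vec, Mesh.IsRT w → ∀ γ : Set (Eucl d),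
          ∑ S ∈ 𝒯.sidesOn γ, ∫ x in S.carrier, Mesh.normalTrace w S x * χ S ∂(Mesh.surf d) =
            ∑ S ∈ 𝒯.sidesOn γ, S.area * (Mesh.flow w S * χ S) := fun w hw γ =>
        Finset.sum_congr rfl fun S hS =>
          Mesh.setIntegral_normalTrace_mul hd hΩ hw.hasConstNormal (Mesh.mem_sidesOn.1 hS).1 _
      rw [if_pos hyd, sub_zero, EReal.coe_le_coe_iff, hint y hy', hint y hy', hint _ hRT,
        hint _ hRT]
      exact Mesh.dualReal_le hd hΩ hΓ h𝒯 hχ hu.1 hyd hz (Mesh.projVec_flux f u)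
        fun S hS => (hC S hS).2
    -- An inadmissible competitor has dual energy -∞.
    · rw [if_neg hyd, sub_eq_add_neg, EReal.neg_top, EReal.add_bot]
      exact bot_le
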